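/- All graphs are finite and simple. A signed graph $(G,\sigma)$ is a graph $G$ with a signature $\sigma:E(G)\to\{-,+\}$; subgraphs of $G$ carry the restricted signature, still written $\sigma$. Switching a set $S\subseteq V(G)$ means changing the signs of all edges between $S$ and $V(G)\setminus S$; signatures obtained from each other by switching are called equivalent. For $k\ge 1$ let $M_k=\{\pm1,\dots,\pm n\}$ if $k=2n$, and $M_k=\{0,\pm1,\dots,\pm n\}$ if $k=2n+1$. Let $K_k^*$ be the signed multigraph whose vertices are the nonnegative elements of $M_k$, in which every two distinct vertices are joined by one positive and one negative edge, and in which every nonzero vertex carries one negative loop (and there are no other edges). A $k$-colouring $\phi:V(G)\to M_k$ of $(G,\sigma)$ is complete if the following operations turn $(G,\sigma)$ into $K_k^*$: switch all vertices with a negative colour, a vertex of colour $c$ receiving the colour $|c|$; identify all vertices of the same colour $i$ to one vertex $i$; keep only one edge of each sign between any two (possibly equal) vertices. The achromatic number $\psi(G,\sigma)$ is the largest $k\ge 1$ such that some $(G,\sigma')$ with $\sigma'$ equivalent to $\sigma$ has a complete $k$-colouring. **Theorem.** Let $(G,\sigma)$ be a signed graph. For every $e\in E(G)$, $$\psi(G,\sigma)-2\le\psi(G-e,\sigma)\le\psi(G,\sigma)+2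 .$$ Both bounds are attained: 1. for every $k\ge5$ there are a signed graph $(G,\sigma)$ and an edge $e$ of $G$ with $\psi(G,\sigma)=k$ and $\psi(G-e,\sigma)=k-2$; 2. for every $k\ge6$ there are a signed graph $(G,\sigma)$ and an edge $e$ of $G$ with $\psi(G,\sigma)=k$ and $\psi(G-e,\sigma)=k+2$. The upper bound is attained, in particular, by the following two families of graphs, in which all edges are negative. 3. Let $H_3$ have the vertices $k_1,k_2,k_3,v_1,v_2,v_3,v_4,w_3$, where $k_1,k_2,k_3$ are pairwise adjacent, each $v_j$ is adjacent exactly to $k_1,k_2$, and $w_3$ is adjacent exactly to $k_1,k_2,k_3$. For $p\ge3$, obtain $H_{p+1}$ from $H_p$ by adding three vertices $w_p',k_{p+1},w_{p+1}$, each joined to all of $k_1,\dots,k_p$, and the edge $k_{p+1}w_{p+1}$. For every $p\ge3$, $\psi(H_p,-)=2p-2$ and $\psi(H_p-k_1v_1,-)=2p$. 4. For $p\ge3$ let $B_p$ be the complete bipartite graph with parts $\{u_1,\dots,u_p\}$ and $\{v_1,\dots,v_{2p+1}\}$ minus the matching $\{u_2v_2,\dots,u_{p-1}v_{p-1}\}$.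 Then $\psi(B_p,-)=2p-1$ and $\psi(B_p-u_pv_p,-)=2p+1$. -/

import Mathlib

namespace SignedGraph

/-! A signed graph `(G, σ)` is given by a simple graph `G` on `V` and a function
`σ : Sym2 V → ℤˣ` whose values on the edges of `G` are the signs (`1` positive, `-1` negative).
The values of `σ` outside `G.edgeSet` play no role; in this way the same `σ` is
a signature of every subgraph of `G`. -/

/-- The edge cut between `S` and its complement, as a set of pairs of vertices. -/
def cut {V : Type*} (S : Set V) : Set (Sym2 V) :=
  {e | ∃ u ∈ S, ∃ v ∉ S, e = s(u, v)}

open Classical in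
/-- The signature obtained by switching the vertices of `S`:
the signs of the edges in the cut between `S` and its complement are changed.
Signatures equivalent to `σ` are those of the form `switch σ S`. -/
noncomputable def switch {V : Type*} (σ : Sym2 V → ℤˣ) (S : Set V) : Sym2 V → ℤˣ :=
  fun e => if e ∈ cut S then -σ e else σ e

/-- The set of colours `M_k`: `{±1, …, ±n}` if `k = 2n`, `{0, ±1, …, ±n}` if `k = 2n + 1`. -/
def colours (k : ℕ) : Set ℤ :=
  {c | c.natAbs ≤ k / 2 ∧ (Even k → c ≠ 0)}

/-- Signed multigraphs with vertices labelled by natural numbers, loops allowed, in which two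
(possibly equal) vertices are joined by at most one edge of each sign:
an edge is the pair of its ends together with its sign. -/
@[ext]
structure Multi where
  verts : Set ℕ
  edges : Set (Sym2 ℕ × ℤˣ)

/-- The signed complete multigraph `K_k^*`: its vertices are the nonnegative elements of `M_k`,
any two distinct vertices are joined by a positive and a negative edge, and there is
a negative loop at each nonzero vertex. -/
def completeMulti (k : ℕ) : Multi where
  verts := {i | (i : ℤ) ∈ colours k}
  edges := {x | ∃ i j : ℕ, (i : ℤ) ∈ colours k ∧ (j : ℤ) ∈ colours k ∧ x.1 = s(i, j) ∧
    (i ≠ j ∨ (i = j ∧ i ≠ 0 ∧ x.2 = -1))}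

/-- The reduced signed graph `R(G, σ, φ)`: switch the vertices with a negative colour (so that a
vertex of colour `c` gets the colour `|c|`), identify vertices of the same colour, and keep one
edge for each pair of ends and each sign. -/
noncomputable def reduced {V : Type*} (G : SimpleGraph V) (σ : Sym2 V → ℤˣ) (φ : V → ℤ) :
    Multi where
  verts := Set.range fun v => (φ v).natAbs
  edges := {x | ∃ u v : V, G.Adj u v ∧ x.1 = s((φ u).natAbs, (φ v).natAbs) ∧
    x.2 = switch σ {w | φ w < 0} s(u, v)}

/-- `φ` is a complete `k`-colouring of `(G, σ)`: a `k`-colouring with reduced graph `K_k^*`. -/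
def IsCompleteColouring {V : Type*} (G : SimpleGraph V) (σ : Sym2 V → ℤˣ) (k : ℕ)
    (φ : V → ℤ) : Prop :=
  (∀ v, φ v ∈ colours k) ∧ reduced G σ φ = completeMulti k

/-- The achromatic number `ψ(G, σ)`: the largest `k ≥ 1` such that some signed graph equivalent to
`(G, σ)` admits a complete `k`-colouring. For a finite nonempty vertex set, the set of such `k` is
nonempty and bounded, so that the supremum is a maximum. -/
noncomputable def achromaticNumber {V : Type*} (G : SimpleGraph V) (σ : Sym2 V → ℤˣ) : ℕ :=
  sSup {k | 1 ≤ k ∧ ∃ (S : Set V) (φ : V → ℤ), IsCompleteColouring G (switch σ S) k φ}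

/-- The signature with all edges negative. -/
def allNegative (V : Type*) : Sym2 V → ℤˣ := fun _ => -1

/-! A recursive family `H_3, H_4, …` of graphs; `H_{q+3}` is `cliqueFamily q`.
In `H_3` the vertices `0, 1, 2` of `Fin 8` are `k_1, k_2, k_3`, the vertices `3, 4, 5, 6` are
`v_1, v_2, v_3, v_4`, and `7` is `w_3`. In each later step, the vertices `0, 1, 2` of the
new `Fin 3` are `w'_p`, `k_{p+1}`, `w_{p+1}`. -/

/-- The vertices of `H_{q+3}`. -/
def FamilyVertex : ℕ → Type
  | 0 => Fin 8
  | q + 1 => FamilyVertex q ⊕ Fin 3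

/-- The vertices `k_1, …, k_{q+3}` of `H_{q+3}`. -/
def IsCore : (q : ℕ) → FamilyVertex q → Prop
  | 0 => fun (i : Fin 8) => i < 3
  | q + 1 => Sum.elim (IsCore q) (fun j : Fin 3 => j = 1)

/-- In `H_3`, the vertices `k_1, k_2, k_3` form a clique, `v_1, …, v_4` are joined to `k_1, k_2`,
and `w_3` is joined to `k_1, k_2, k_3`; so `k_1, k_2` are joined to all other vertices, and
the only further edge is `k_3 w_3`. To get
`H_{p+1}` from `H_p`, add `w'_p, k_{p+1}, w_{p+1}`, all joined to `k_1, …, k_p`, and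
join `k_{p+1}` and `w_{p+1}`. Each edge is listed in at least one direction. -/
def FamilyRel : (q : ℕ) → FamilyVertex q → FamilyVertex q → Prop
  | 0 => fun (i j : Fin 8) => i < j ∧ (i < 2 ∨ (i = 2 ∧ j = 7))
  | q + 1 => fun x y => match x, y with
    | Sum.inl a, Sum.inl b => FamilyRel q a b
    | Sum.inl a, Sum.inr _ => IsCore q a
    | Sum.inr i, Sum.inr j => i = 1 ∧ j = 2
    | Sum.inr _, Sum.inl _ => False

/-- The graph `H_{q+3}`. -/
def cliqueFamily (q : ℕ) : SimpleGraph (FamilyVertex q) :=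
  SimpleGraph.fromRel (FamilyRel q)

/-- The inclusion of the vertices of `H_3` in those of `H_{q+3}`. -/
def baseVertex : (q : ℕ) → Fin 8 → FamilyVertex q
  | 0 => fun i => i
  | q + 1 => fun i => Sum.inl (baseVertex q i)

/-- The edge `k_1 v_1` of `H_{q+3}`. -/
def familyEdge (q : ℕ) : Sym2 (FamilyVertex q) :=
  s(baseVertex q 0, baseVertex q 3)

/-- The complete bipartite graph with parts `u_1, …, u_p` and `v_1, …, v_{2p+1}`, minus the
matching `u_2 v_2, …, u_{p-1} v_{p-1}` (indices are shifted by one in `Fin`). -/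
def bipartiteMinusMatching (p : ℕ) : SimpleGraph (Fin p ⊕ Fin (2 * p + 1)) :=
  (completeBipartiteGraph (Fin p) (Fin (2 * p + 1))).deleteEdges
    {e | ∃ (i : Fin p) (j : Fin (2 * p + 1)), e = s(Sum.inl i, Sum.inr j) ∧
      i.val = j.val ∧ 1 ≤ i.val ∧ i.val + 1 < p}

/-- The edge `u_p v_p` of the preceding graph, for `p ≥ 1`. -/
def bipartiteEdge (p : ℕ) (hp : 1 ≤ p) : Sym2 (Fin p ⊕ Fin (2 * p + 1)) :=
  s(Sum.inl ⟨p - 1, by omega⟩, Sum.inr ⟨p - 1, by omega⟩)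

end SignedGraph

/-! Up to switching, a complete `k`-colouring consists of the absolute values `c` of the colours and
a sign `t v` at each vertex: switching to an equivalent signature and switching the negative colours
multiply into one sign. `PartialColouring` records such data on an induced subgraph.

The two bounds rest on the fact that `ψ` does not increase when passing to an induced subgraph
(`PartialColouring.exists_insert`). To add a vertex `v`, look for a nonzero class to which `v` lacks
an edge of some sign; then `v` can be switched so that all its edges to this class are negative, and
it joins the class. If there is none, `v` alone supplies both signs to all nonzero classes, so it
can become the class `0`, join it, or turn it into a new nonzero class. Now let two graphs differ
only in the edge `e`. Removing a class that contains an end of `e` costs at most two colours and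
leaves an induced subgraph on which both graphs agree, so their achromatic numbers differ by at most
two, in either direction.

For sharpness, every nonzero class contains an edge and hence meets every vertex cover `C`, so `k /
2 ≤ |C|`. In an all-negative graph, two vertices that are adjacent to all other vertices of their
classes must share a class, since otherwise only one sign occurs between the classes
(`PartialColouring.eq_of_twins`). This lowers the bound to `2|C| - 1`, and to `2|C| - 2` for `H_p`.
Deleting an edge at one of the two vertices destroys the obstruction, and an explicit colouring
gains two colours. A positive edge between the two vertices also destroys it; deleting that edge
loses two colours. In each case one value is bounded above, the other below, and the general bound
on the difference determines both. -/

namespace SignedGraph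

/-! ### Complete colourings up to switching -/

/-- The nonnegative elements of `M_k`. -/
def IsIndex (k i : ℕ) : Prop := i ≤ k / 2 ∧ (Even k → i ≠ 0)

/-- Complete `k`-colourings of the subgraph induced by `W`, up to switching: `c` gives the absolute
values of the colours, and `t` the vertices that are switched. -/
structure PartialColouring {V : Type*} (G : SimpleGraph V) (σ : Sym2 V → ℤˣ) (k : ℕ) (W : Set V)
    (c : V → ℕ) (t : V → ℤˣ) : Prop where
  mem : ∀ v ∈ W, IsIndex k (c v)
  surj : ∀ i, IsIndex k i → ∃ v ∈ W, c v = i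
  inner : ∀ u ∈ W, ∀ v ∈ W, G.Adj u v → c u = c v → c u ≠ 0 ∧ σ s(u, v) * t u * t v = -1
  loop : ∀ i, 1 ≤ i → i ≤ k / 2 → ∃ u ∈ W, ∃ v ∈ W, G.Adj u v ∧ c u = i ∧ c v = i
  pair : ∀ i j, i < j → IsIndex k i → j ≤ k / 2 → ∀ s : ℤˣ,
    ∃ u ∈ W, ∃ v ∈ W, G.Adj u v ∧ c u = i ∧ c v = j ∧ σ s(u, v) * t u * t v = s

theorem coe_mem_colours {k i : ℕ} : (i : ℤ) ∈ colours k ↔ IsIndex k i := by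
  simp [colours, IsIndex]

theorem natAbs_isIndex {k : ℕ} {z : ℤ} : z ∈ colours k ↔ IsIndex k z.natAbs := by
  simp [colours, IsIndex]

open Classical in
/-- The sign by which switching `S` multiplies the edges at a vertex. -/
noncomputable def switchSign {V : Type*} (S : Set V) (v : V) : ℤˣ := if v ∈ S then -1 else 1

theorem mk_mem_cut {V : Type*} {S : Set V} {u v : V} :
    s(u, v) ∈ cut S ↔ (u ∈ S ∧ v ∉ S) ∨ (v ∈ S ∧ u ∉ S) := by
  constructor
  · rintro ⟨a, ha, b, hb, h⟩
    rcases Sym2.eq_iff.1 h with ⟨rfl, rfl⟩ | ⟨rfl, rfl⟩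
    · exact Or.inl ⟨ha, hb⟩
    · exact Or.inr ⟨ha, hb⟩
  · rintro (⟨h1, h2⟩ | ⟨h1, h2⟩)
    · exact ⟨u, h1, v, h2, rfl⟩
    · exact ⟨v, h1, u, h2, Sym2.eq_swap⟩

theorem switch_mk {V : Type*} (σ : Sym2 V → ℤˣ) (S : Set V) (u v : V) :
    switch σ S s(u, v) = σ s(u, v) * switchSign S u * switchSign S v := by
  unfold switch switchSign
  rw [mk_mem_cut]
  by_cases hu : u ∈ S <;> by_cases hv : v ∈ S <;> simp [hu, hv]

theorem switchSign_setOf {V : Type*} (t : V → ℤˣ) (v : V) :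
    switchSign {w | t w = -1} v = t v := by
  rcases Int.units_eq_one_or (t v) with h | h <;> simp [switchSign, h]

/-- Switching `S` and then the negatively coloured vertices multiplies the edges at `v` by the
product of two signs, which serves as `t v`. -/
theorem PartialColouring.of_isCompleteColouring {V : Type*} {G : SimpleGraph V}
    {σ : Sym2 V → ℤˣ} {k : ℕ} {S : Set V} {φ : V → ℤ}
    (h : IsCompleteColouring G (switch σ S) k φ) :
    PartialColouring G σ k Set.univ (fun v => (φ v).natAbs)
      (fun v => switchSign S v * switchSign {w | φ w < 0} v) := by
  obtain ⟨h1, h2⟩ := h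
  have hv : ∀ i, i ∈ (reduced G (switch σ S) φ).verts ↔ i ∈ (completeMulti k).verts := by
    simp [h2]
  have he : ∀ x, x ∈ (reduced G (switch σ S) φ).edges ↔ x ∈ (completeMulti k).edges := by
    simp [h2]
  have hs : ∀ u v, switch (switch σ S) {w | φ w < 0} s(u, v) =
      σ s(u, v) * (switchSign S u * switchSign {w | φ w < 0} u) *
        (switchSign S v * switchSign {w | φ w < 0} v) := by
    intro u v
    rw [switch_mk, switch_mk]
    ac_rfl
  refine ⟨fun v _ => natAbs_isIndex.1 (h1 v), fun i hi => ?_, fun u _ v _ huv hc => ?_,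
    fun i hi hik => ?_, fun i j hij hi hj s => ?_⟩
  · obtain ⟨v, hv⟩ := (hv i).2 (coe_mem_colours.2 hi)
    exact ⟨v, trivial, hv⟩
  · obtain ⟨i, j, -, -, hx, hor⟩ := (he (s((φ u).natAbs, (φ v).natAbs), _)).1 ⟨u, v, huv, rfl, rfl⟩
    simp only at hc hx hor
    rw [hc] at hx
    have hij : i = j := by
      rcases Sym2.eq_iff.1 hx with ⟨h, h'⟩ | ⟨h, h'⟩ <;> omega
    subst hij
    have hi : (φ v).natAbs = i := by
      rcases Sym2.eq_iff.1 hx with ⟨h, h'⟩ | ⟨h, h'⟩ <;> omega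
    simp only [ne_eq, not_true_eq_false, true_and, false_or] at hor
    rw [← hs]
    exact ⟨by omega, hor.2⟩
  · have hI : IsIndex k i := ⟨hik, fun _ => by omega⟩
    obtain ⟨u, v, huv, hx, -⟩ := (he (s(i, i), -1)).2 ⟨i, i, coe_mem_colours.2 hI,
      coe_mem_colours.2 hI, rfl, Or.inr ⟨rfl, by omega, rfl⟩⟩
    refine ⟨u, trivial, v, trivial, huv, ?_⟩
    rcases Sym2.eq_iff.1 hx with ⟨h, h'⟩ | ⟨h, h'⟩ <;> exact ⟨by omega, by omega⟩
  · have hJ : IsIndex k j := ⟨hj, fun _ => by omega⟩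
    obtain ⟨u, v, huv, hx, hsx⟩ := (he (s(i, j), s)).2 ⟨i, j, coe_mem_colours.2 hi,
      coe_mem_colours.2 hJ, rfl, Or.inl (by omega)⟩
    simp only at hx hsx
    rcases Sym2.eq_iff.1 hx with ⟨h, h'⟩ | ⟨h, h'⟩
    · exact ⟨u, trivial, v, trivial, huv, h.symm, h'.symm, by rw [hsx, hs]⟩
    · refine ⟨v, trivial, u, trivial, huv.symm, h.symm, h'.symm, ?_⟩
      rw [hsx, Sym2.eq_swap, hs]
      ac_rfl

/-- All of `t` can be absorbed into the equivalent signature, so nonnegative colours suffice and no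
vertex is left to be switched. -/
theorem PartialColouring.isCompleteColouring {V : Type*} {G : SimpleGraph V}
    {σ : Sym2 V → ℤˣ} {k : ℕ} {c : V → ℕ} {t : V → ℤˣ}
    (h : PartialColouring G σ k Set.univ c t) :
    IsCompleteColouring G (switch σ {w | t w = -1}) k (fun v => (c v : ℤ)) := by
  have hs : ∀ u v, switch (switch σ {w | t w = -1}) {w | (c w : ℤ) < 0} s(u, v) =
      σ s(u, v) * t u * t v := by
    intro u v
    rw [switch_mk, switch_mk, switchSign_setOf, switchSign_setOf]
    have : {w | (c w : ℤ) < 0} = ∅ := by ext; simp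
    simp [this, switchSign]
  refine ⟨fun v => coe_mem_colours.2 (h.mem v trivial), ?_⟩
  ext x
  · constructor
    · rintro ⟨v, rfl⟩
      exact coe_mem_colours.2 (by simpa using h.mem v trivial)
    · intro hx
      obtain ⟨v, -, hv⟩ := h.surj x (coe_mem_colours.1 hx)
      exact ⟨v, by simpa using hv⟩
  · constructor
    · rintro ⟨u, v, huv, hx, hsx⟩
      refine ⟨c u, c v, coe_mem_colours.2 (h.mem u trivial), coe_mem_colours.2 (h.mem v trivial),
        by simpa using hx, ?_⟩
      by_cases hc : c u = c v
      · have := h.inner u trivial v trivial huv hc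
        exact Or.inr ⟨hc, this.1, by rw [hsx, hs, this.2]⟩
      · exact Or.inl hc
    · obtain ⟨x, s⟩ := x
      rintro ⟨i, j, hi, hj, hx, hor⟩
      rw [coe_mem_colours] at hi hj
      simp only at hx hor
      subst hx
      rcases lt_trichotomy i j with hij | hij | hij
      · obtain ⟨u, -, v, -, huv, rfl, rfl, hs'⟩ := h.pair i j hij hi hj.1 s
        exact ⟨u, v, huv, by simp, by rw [hs, hs']⟩
      · subst hij
        simp only [ne_eq, not_true_eq_false, true_and, false_or] at hor
        obtain ⟨u, -, v, -, huv, hu, hv⟩ := h.loop i (by omega) hi.1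
        have := h.inner u trivial v trivial huv (by omega)
        exact ⟨u, v, huv, by simp [hu, hv], by rw [hs, this.2]; exact hor.2⟩
      · obtain ⟨u, -, v, -, huv, rfl, rfl, hs'⟩ := h.pair j i hij hj hi.1 s
        exact ⟨v, u, huv.symm, by simp,
          by rw [hs, ← hs', mul_right_comm, Sym2.eq_swap (a := u)]⟩

theorem setOf_colouring_eq {V : Type*} (G : SimpleGraph V) (σ : Sym2 V → ℤˣ) :
    {k | 1 ≤ k ∧ ∃ (S : Set V) (φ : V → ℤ), IsCompleteColouring G (switch σ S) k φ} =
      {k | 1 ≤ k ∧ ∃ c t, PartialColouring G σ k Set.univ c t} := by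
  ext k
  constructor
  · rintro ⟨hk, S, φ, h⟩
    exact ⟨hk, _, _, PartialColouring.of_isCompleteColouring h⟩
  · rintro ⟨hk, c, t, h⟩
    exact ⟨hk, _, _, h.isCompleteColouring⟩

theorem achromaticNumber_eq {V : Type*} (G : SimpleGraph V) (σ : Sym2 V → ℤˣ) :
    achromaticNumber G σ = sSup {k | 1 ≤ k ∧ ∃ c t, PartialColouring G σ k Set.univ c t} := by
  rw [achromaticNumber, setOf_colouring_eq]

theorem PartialColouring.half_le_card {V : Type*} [Finite V] {G : SimpleGraph V}
    {σ : Sym2 V → ℤˣ} {k : ℕ} {W : Set V} {c : V → ℕ} {t : V → ℤˣ}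
    (h : PartialColouring G σ k W c t) : k / 2 ≤ Nat.card V := by
  have := Fintype.ofFinite V
  have hsub : Finset.Icc 1 (k / 2) ⊆ Finset.univ.image c := by
    intro i hi
    rw [Finset.mem_Icc] at hi
    obtain ⟨v, -, hv⟩ := h.surj i ⟨hi.2, fun _ => by omega⟩
    exact Finset.mem_image.2 ⟨v, Finset.mem_univ v, hv⟩
  have h1 := Finset.card_le_card hsub
  have h2 := Finset.card_image_le (s := (Finset.univ : Finset V)) (f := c)
  rw [Nat.card_eq_fintype_card, Fintype.card]
  simp only [Nat.card_Icc] at h1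
  omega

theorem bddAbove_colourings {V : Type*} [Finite V] (G : SimpleGraph V) (σ : Sym2 V → ℤˣ) :
    BddAbove {k | 1 ≤ k ∧ ∃ c t, PartialColouring G σ k Set.univ c t} := by
  refine ⟨2 * Nat.card V + 1, ?_⟩
  rintro k ⟨-, c, t, h⟩
  have := h.half_le_card
  omega

theorem PartialColouring.le_achromaticNumber {V : Type*} [Finite V] {G : SimpleGraph V}
    {σ : Sym2 V → ℤˣ} {k : ℕ} {c : V → ℕ} {t : V → ℤˣ}
    (h : PartialColouring G σ k Set.univ c t) : k ≤ achromaticNumber G σ := by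
  rcases Nat.eq_zero_or_pos k with rfl | hk
  · exact Nat.zero_le _
  · rw [achromaticNumber_eq]
    exact le_csSup (bddAbove_colourings G σ) ⟨hk, c, t, h⟩

theorem achromaticNumber_le {V : Type*} {G : SimpleGraph V} {σ : Sym2 V → ℤˣ} {m : ℕ}
    (h : ∀ k c t, PartialColouring G σ k Set.univ c t → k ≤ m) : achromaticNumber G σ ≤ m := by
  rw [achromaticNumber_eq]
  -- In `ℕ` the supremum of the empty set is `0`, so no colouring has to exist here.
  refine csSup_le' ?_
  rintro k ⟨-, c, t, hk⟩
  exact h k c t hk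

theorem exists_colouring_achromaticNumber {V : Type*} [Finite V] {G : SimpleGraph V}
    {σ : Sym2 V → ℤˣ} (h : 1 ≤ achromaticNumber G σ) :
    ∃ c t, PartialColouring G σ (achromaticNumber G σ) Set.univ c t := by
  have hne : {k | 1 ≤ k ∧ ∃ c t, PartialColouring G σ k Set.univ c t}.Nonempty := by
    by_contra hne
    rw [Set.not_nonempty_iff_eq_empty] at hne
    rw [achromaticNumber_eq, hne] at h
    simp at h
  have := Nat.sSup_mem hne (bddAbove_colourings G σ)
  rw [← achromaticNumber_eq] at this
  exact this.2


/-! ### Induced subgraphs and the change of one edge -/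

theorem units_eq_neg_of_ne {a b : ℤˣ} (h : a ≠ b) : a = -b := by
  rcases Int.units_eq_one_or a with rfl | rfl <;> rcases Int.units_eq_one_or b with rfl | rfl <;>
    simp_all

section

variable {V : Type*} {G : SimpleGraph V} {σ : Sym2 V → ℤˣ} {k : ℕ} {W : Set V} {c : V → ℕ}
  {t : V → ℤˣ}

theorem PartialColouring.congr (h : PartialColouring G σ k W c t) {c' : V → ℕ} {t' : V → ℤˣ}
    (hc : ∀ v ∈ W, c' v = c v) (ht : ∀ v ∈ W, t' v = t v) : PartialColouring G σ k W c' t' where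
  mem v hv := by rw [hc v hv]; exact h.mem v hv
  surj i hi := by
    obtain ⟨v, hv, rfl⟩ := h.surj i hi
    exact ⟨v, hv, hc v hv⟩
  inner u hu v hv huv he := by
    rw [hc u hu, hc v hv] at he
    rw [hc u hu, ht u hu, ht v hv]
    exact h.inner u hu v hv huv he
  loop i hi hik := by
    obtain ⟨u, hu, v, hv, huv, h1, h2⟩ := h.loop i hi hik
    exact ⟨u, hu, v, hv, huv, by rw [hc u hu, h1], by rw [hc v hv, h2]⟩
  pair i j hij hi hj s := by
    obtain ⟨u, hu, v, hv, huv, h1, h2, h3⟩ := h.pair i j hij hi hj s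
    exact ⟨u, hu, v, hv, huv, by rw [hc u hu, h1], by rw [hc v hv, h2],
      by rw [ht u hu, ht v hv, h3]⟩

theorem PartialColouring.pair_ne (h : PartialColouring G σ k W c t) {i j : ℕ} (hij : i ≠ j)
    (hi : IsIndex k i) (hj : IsIndex k j) (s : ℤˣ) :
    ∃ u ∈ W, ∃ v ∈ W, G.Adj u v ∧ c u = i ∧ c v = j ∧ σ s(u, v) * t u * t v = s := by
  rcases lt_or_gt_of_ne hij with hlt | hlt
  · exact h.pair i j hlt hi hj.1 s
  · obtain ⟨u, hu, v, hv, huv, h1, h2, h3⟩ := h.pair j i hlt hj hi.1 s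
    refine ⟨v, hv, u, hu, huv.symm, h2, h1, ?_⟩
    rw [Sym2.eq_swap, mul_right_comm, h3]

/-- A complete colouring of an induced subgraph restricts to one of another graph that has the
same edges inside the set. -/
theorem PartialColouring.congr_graph (h : PartialColouring G σ k W c t) {G' : SimpleGraph V}
    (hG : ∀ u ∈ W, ∀ v ∈ W, G.Adj u v ↔ G'.Adj u v) : PartialColouring G' σ k W c t where
  mem := h.mem
  surj := h.surj
  inner u hu v hv huv := h.inner u hu v hv ((hG u hu v hv).2 huv)
  loop i hi hik := by
    obtain ⟨u, hu, v, hv, huv, h'⟩ := h.loop i hi hik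
    exact ⟨u, hu, v, hv, (hG u hu v hv).1 huv, h'⟩
  pair i j hij hi hj s := by
    obtain ⟨u, hu, v, hv, huv, h'⟩ := h.pair i j hij hi hj s
    exact ⟨u, hu, v, hv, (hG u hu v hv).1 huv, h'⟩

/-- Removing a nonzero colour class. -/
theorem PartialColouring.remove_class (h : PartialColouring G σ k W c t) {i : ℕ} (hi : 1 ≤ i)
    (hik : i ≤ k / 2) :
    ∃ c', PartialColouring G σ (k - 2) {v ∈ W | c v ≠ i} c' t := by
  have hdiv : (k - 2) / 2 = k / 2 - 1 := by omega
  have hpar : Even (k - 2) ↔ Even k := by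
    rw [Nat.even_iff, Nat.even_iff]; omega
  -- The top class takes over the vacated number `i`; `g` is the inverse renumbering.
  let f : ℕ → ℕ := fun j => if j = k / 2 then i else j
  let g : ℕ → ℕ := fun j => if j = i then k / 2 else j
  have hidx : ∀ j, IsIndex k j → j ≠ i → IsIndex (k - 2) (f j) := by
    rintro j ⟨hj, hj'⟩ hne
    simp only [IsIndex, hdiv, hpar, f]
    split_ifs with hjk
    · exact ⟨by omega, fun _ => by omega⟩
    · exact ⟨by omega, hj'⟩
  have hidx' : ∀ j, IsIndex (k - 2) j → IsIndex k (g j) ∧ g j ≠ i ∧ f (g j) = j := by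
    rintro j ⟨hj, hj'⟩
    rw [hdiv] at hj
    rw [hpar] at hj'
    simp only [IsIndex, f, g]
    split_ifs with hjk
    · subst hjk
      exact ⟨⟨le_rfl, fun _ => by omega⟩, by omega, rfl⟩
    · omega
    · omega
    · exact ⟨⟨by omega, hj'⟩, hjk, rfl⟩
  have hinj : ∀ a b, a ≠ i → b ≠ i → f a = f b → a = b := by
    intro a b ha hb hab
    simp only [f] at hab
    split_ifs at hab <;> omega
  have hg : ∀ a b, IsIndex (k - 2) a → IsIndex (k - 2) b → g a = g b → a = b := by
    intro a b ha hb hab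
    rw [← (hidx' a ha).2.2, hab, (hidx' b hb).2.2]
  refine ⟨fun v => f (c v), fun v hv => hidx _ (h.mem v hv.1) hv.2, fun j hj => ?_,
    fun u hu v hv huv hc => ?_, fun j hj hjk => ?_, fun a b hab ha hb s => ?_⟩
  · obtain ⟨h1, h2, h3⟩ := hidx' j hj
    obtain ⟨v, hv, hcv⟩ := h.surj _ h1
    exact ⟨v, ⟨hv, by rw [hcv]; exact h2⟩, by rw [hcv, h3]⟩
  · have := h.inner u hu.1 v hv.1 huv (hinj _ _ hu.2 hv.2 hc)
    refine ⟨?_, this.2⟩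
    simp only [f]
    split_ifs <;> omega
  · obtain ⟨h1, h2, h3⟩ := hidx' j ⟨hjk, fun _ => by omega⟩
    have : 1 ≤ g j := by simp only [g]; split_ifs <;> omega
    obtain ⟨u, hu, v, hv, huv, hcu, hcv⟩ := h.loop _ this h1.1
    exact ⟨u, ⟨hu, by rw [hcu]; exact h2⟩, v, ⟨hv, by rw [hcv]; exact h2⟩, huv,
      by rw [hcu, h3], by rw [hcv, h3]⟩
  · have hb' : IsIndex (k - 2) b := ⟨hb, fun _ => by omega⟩
    obtain ⟨h1, h2, h3⟩ := hidx' a ha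
    obtain ⟨h1', h2', h3'⟩ := hidx' b hb'
    obtain ⟨u, hu, v, hv, huv, hcu, hcv, hs⟩ :=
      h.pair_ne (fun hgab => hab.ne (hg a b ha hb' hgab)) h1 h1' s
    exact ⟨u, ⟨hu, by rw [hcu]; exact h2⟩, v, ⟨hv, by rw [hcv]; exact h2'⟩, huv,
      by rw [hcu, h3], by rw [hcv, h3'], hs⟩

/-- Removing the colour class `0`. -/
theorem PartialColouring.remove_zero (h : PartialColouring G σ k W c t) (hk : ¬ Even k) :
    PartialColouring G σ (k - 1) {v ∈ W | c v ≠ 0} c t := by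
  rw [Nat.even_iff] at hk
  have hdiv : (k - 1) / 2 = k / 2 := by omega
  have hpar : Even (k - 1) := by rw [Nat.even_iff]; omega
  have hidx : ∀ j, IsIndex (k - 1) j → IsIndex k j := fun j hj => by
    refine ⟨by have := hj.1; omega, fun _ => hj.2 hpar⟩
  refine ⟨fun v hv => ⟨by rw [hdiv]; exact (h.mem v hv.1).1, fun _ => hv.2⟩, fun j hj => ?_,
    fun u hu v hv => h.inner u hu.1 v hv.1, fun j hj hjk => ?_, fun a b hab ha hb s => ?_⟩
  · obtain ⟨v, hv, rfl⟩ := h.surj j (hidx j hj)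
    exact ⟨v, ⟨hv, hj.2 hpar⟩, rfl⟩
  · obtain ⟨u, hu, v, hv, huv, hcu, hcv⟩ := h.loop j hj (by omega)
    exact ⟨u, ⟨hu, by omega⟩, v, ⟨hv, by omega⟩, huv, hcu, hcv⟩
  · have ha' := ha.2 hpar
    obtain ⟨u, hu, v, hv, huv, hcu, hcv, hs⟩ := h.pair a b hab (hidx a ha) (by omega) s
    exact ⟨u, ⟨hu, by omega⟩, v, ⟨hv, by omega⟩, huv, hcu, hcv, hs⟩

/-- If adding `v` to a colour class creates no bad edge, then the colouring extends to `v`. -/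
theorem PartialColouring.insert_class (h : PartialColouring G σ k W c t) {v : V} (hv : v ∉ W)
    {i : ℕ} (hi : IsIndex k i) (s : ℤˣ)
    (hins : ∀ w ∈ W, G.Adj v w → c w = i → i ≠ 0 ∧ σ s(v, w) * s * t w = -1) :
    ∃ c' t', PartialColouring G σ k (insert v W) c' t' := by
  classical
  have hne : ∀ w ∈ W, w ≠ v := fun w hw he => hv (he ▸ hw)
  have h' : PartialColouring G σ k W (Function.update c v i) (Function.update t v s) :=
    h.congr (fun w hw => Function.update_of_ne (hne w hw) _ _)
      (fun w hw => Function.update_of_ne (hne w hw) _ _)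
  refine ⟨Function.update c v i, Function.update t v s, ?_, fun j hj => ?_, ?_,
    fun j hj hjk => ?_, fun a b hab ha hb r => ?_⟩
  · rintro w (rfl | hw)
    · simpa using hi
    · exact h'.mem w hw
  · obtain ⟨w, hw, hcw⟩ := h'.surj j hj
    exact ⟨w, Or.inr hw, hcw⟩
  · rintro u (rfl | hu) w (rfl | hw) huw hc
    · exact absurd huw (G.irrefl)
    · simp only [Function.update_self, Function.update_of_ne (hne w hw)] at hc ⊢
      exact hins w hw huw hc.symm
    · simp only [Function.update_self, Function.update_of_ne (hne u hu)] at hc ⊢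
      have := hins u hu huw.symm hc
      refine ⟨by omega, ?_⟩
      rw [Sym2.eq_swap, mul_right_comm, this.2]
    · exact h'.inner u hu w hw huw hc
  · obtain ⟨u, hu, w, hw, huw⟩ := h'.loop j hj hjk
    exact ⟨u, Or.inr hu, w, Or.inr hw, huw⟩
  · obtain ⟨u, hu, w, hw, huw⟩ := h'.pair a b hab ha hb r
    exact ⟨u, Or.inr hu, w, Or.inr hw, huw⟩

/-- If `v` has edges of both signs to all nonzero classes, then for even `k` it can form
the class `0`. -/
theorem PartialColouring.insert_zero (h : PartialColouring G σ k W c t) {v : V} (hv : v ∉ W)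
    (hk : Even k)
    (hins : ∀ i, 1 ≤ i → i ≤ k / 2 → ∀ s : ℤˣ, ∃ w ∈ W, G.Adj v w ∧ c w = i ∧
      σ s(v, w) * t w = s) :
    ∃ c' t', PartialColouring G σ (k + 1) (insert v W) c' t' := by
  classical
  have hne : ∀ w ∈ W, w ≠ v := fun w hw he => hv (he ▸ hw)
  have h' : PartialColouring G σ k W (Function.update c v 0) (Function.update t v 1) :=
    h.congr (fun w hw => Function.update_of_ne (hne w hw) _ _)
      (fun w hw => Function.update_of_ne (hne w hw) _ _)
  have hpar : ¬ Even (k + 1) := by rw [Nat.even_iff] at *; omega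
  have hdiv : (k + 1) / 2 = k / 2 := by rw [Nat.even_iff] at *; omega
  have hidx : ∀ j, IsIndex (k + 1) j ↔ j ≤ k / 2 := by simp [IsIndex, hpar, hdiv]
  have hidx' : ∀ j, 1 ≤ j → j ≤ k / 2 → IsIndex k j := fun j hj hjk => ⟨hjk, fun _ => by omega⟩
  refine ⟨Function.update c v 0, Function.update t v 1, ?_, fun j hj => ?_, ?_,
    fun j hj hjk => ?_, fun a b hab ha hb r => ?_⟩
  · rintro w (rfl | hw)
    · rw [hidx]; simp
    · exact (hidx _).2 (h'.mem w hw).1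
  · rw [hidx] at hj
    rcases Nat.eq_zero_or_pos j with rfl | hj'
    · exact ⟨v, Or.inl rfl, by simp⟩
    · obtain ⟨w, hw, hcw⟩ := h'.surj j (hidx' j hj' hj)
      exact ⟨w, Or.inr hw, hcw⟩
  · rintro u (rfl | hu) w (rfl | hw) huw hc
    · exact absurd huw (G.irrefl)
    · rw [Function.update_self] at hc
      exact absurd hc.symm ((h'.mem w hw).2 hk)
    · rw [Function.update_self] at hc
      exact absurd hc ((h'.mem u hu).2 hk)
    · exact h'.inner u hu w hw huw hc
  · obtain ⟨u, hu, w, hw, huw⟩ := h'.loop j hj (by omega)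
    exact ⟨u, Or.inr hu, w, Or.inr hw, huw⟩
  · rw [hdiv] at hb
    rcases Nat.eq_zero_or_pos a with rfl | ha'
    · obtain ⟨w, hw, hvw, hcw, hs⟩ := hins b hab hb r
      refine ⟨v, Or.inl rfl, w, Or.inr hw, hvw, by simp, ?_, ?_⟩
      · rw [Function.update_of_ne (hne w hw), hcw]
      · rw [Function.update_of_ne (hne w hw), Function.update_self, mul_one, hs]
    · obtain ⟨u, hu, w, hw, huw⟩ := h'.pair a b hab (hidx' a ha' (by omega)) hb r
      exact ⟨u, Or.inr hu, w, Or.inr hw, huw⟩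

/-- If `v` has edges of both signs to all nonzero classes and is adjacent to a vertex of
the class `0`, then adding it to this class makes the class nonzero. -/
theorem PartialColouring.insert_top (h : PartialColouring G σ k W c t) {v : V} (hv : v ∉ W)
    (hk : ¬ Even k)
    (hins : ∀ i, 1 ≤ i → i ≤ k / 2 → ∀ s : ℤˣ, ∃ w ∈ W, G.Adj v w ∧ c w = i ∧
      σ s(v, w) * t w = s) {x : V} (hx : x ∈ W) (hvx : G.Adj v x) (hcx : c x = 0) :
    ∃ c' t', PartialColouring G σ (k + 1) (insert v W) c' t' := by
  classical
  have hne : ∀ w ∈ W, w ≠ v := fun w hw he => hv (he ▸ hw)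
  rw [Nat.even_iff] at hk
  have hpar : Even (k + 1) := by rw [Nat.even_iff]; omega
  have hdiv : (k + 1) / 2 = k / 2 + 1 := by omega
  have hidx : ∀ j, IsIndex (k + 1) j ↔ 1 ≤ j ∧ j ≤ k / 2 + 1 := by
    intro j; simp only [IsIndex, hpar, hdiv, true_imp_iff]; omega
  have hidx' : ∀ j, j ≤ k / 2 → IsIndex k j := fun j hjk =>
    ⟨hjk, fun he => by rw [Nat.even_iff] at he; omega⟩
  let c' : V → ℕ := fun w => if w = v ∨ c w = 0 then k / 2 + 1 else c w
  -- The class `0` is independent, so its vertices may be switched anew to make all their edges to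
  -- `v` negative. Nothing is lost: `v` alone supplies both signs between the merged class and the
  -- other ones.
  let t' : V → ℤˣ := fun w => if w = v then 1 else if c w = 0 then
    (if G.Adj v w then -σ s(v, w) else 1) else t w
  have hc'v : c' v = k / 2 + 1 := by simp [c']
  have ht'v : t' v = 1 := by simp [t']
  have hc'0 : ∀ w, c w = 0 → c' w = k / 2 + 1 := fun w hw => by simp [c', hw]
  have hc' : ∀ w ∈ W, c w ≠ 0 → c' w = c w := fun w hw hw' => by simp [c', hne w hw, hw']
  have ht' : ∀ w ∈ W, c w ≠ 0 → t' w = t w := fun w hw hw' => by simp [t', hne w hw, hw']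
  have hinv : ∀ w, v ≠ w → c w = 0 → G.Adj v w → σ s(v, w) * t' w = -1 := by
    intro w hw hw0 hvw
    simp [t', hw.symm, hw0, hvw]
  have hle : ∀ w ∈ W, c w ≤ k / 2 := fun w hw => (h.mem w hw).1
  have hvle : ∀ w ∈ W, c w ≠ 0 → c' w ≠ k / 2 + 1 := fun w hw hw0 => by
    rw [hc' w hw hw0]; have := hle w hw; omega
  refine ⟨c', t', ?_, fun j hj => ?_, ?_, fun j hj hjk => ?_, fun a b hab ha hb r => ?_⟩
  · rintro w (rfl | hw)
    · rw [hidx, hc'v]; omega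
    · rw [hidx]
      have := hle w hw
      by_cases hw0 : c w = 0
      · rw [hc'0 w hw0]; omega
      · rw [hc' w hw hw0]; omega
  · rw [hidx] at hj
    by_cases hjk : j = k / 2 + 1
    · exact ⟨v, Or.inl rfl, by rw [hc'v, hjk]⟩
    · obtain ⟨w, hw, rfl⟩ := h.surj j (hidx' j (by omega))
      exact ⟨w, Or.inr hw, hc' w hw (by omega)⟩
  · rintro u (rfl | hu) w (rfl | hw) huw hc
    · exact absurd huw (G.irrefl)
    · refine ⟨by omega, ?_⟩
      have hw0 : c w = 0 := by
        by_contra hw0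
        exact hvle w hw hw0 (by omega)
      rw [ht'v, mul_one, hinv w (hne w hw).symm hw0 huw]
    · refine ⟨by omega, ?_⟩
      have hu0 : c u = 0 := by
        by_contra hu0
        exact hvle u hu hu0 (by omega)
      rw [ht'v, mul_one, Sym2.eq_swap, hinv u (hne u hu).symm hu0 huw.symm]
    · by_cases hu0 : c u = 0
      · have hw0 : c w = 0 := by
          by_contra hw0
          exact hvle w hw hw0 (by rw [← hc, hc'0 u hu0])
        exact absurd hu0 (h.inner u hu w hw huw (by omega)).1
      · have hw0 : c w ≠ 0 := by
          intro hw0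
          exact hvle u hu hu0 (by rw [hc, hc'0 w hw0])
        rw [hc' u hu hu0, ht' u hu hu0, ht' w hw hw0]
        rw [hc' u hu hu0, hc' w hw hw0] at hc
        exact h.inner u hu w hw huw hc
  · by_cases hj' : j = k / 2 + 1
    · exact ⟨v, Or.inl rfl, x, Or.inr hx, hvx, by omega, by rw [hc'0 x hcx, hj']⟩
    · obtain ⟨u, hu, w, hw, huw, hcu, hcw⟩ := h.loop j hj (by omega)
      exact ⟨u, Or.inr hu, w, Or.inr hw, huw, by rw [hc' u hu (by omega), hcu],
        by rw [hc' w hw (by omega), hcw]⟩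
  · rw [hidx] at ha
    rw [hdiv] at hb
    by_cases hb' : b = k / 2 + 1
    · obtain ⟨w, hw, hvw, hcw, hs⟩ := hins a ha.1 (by omega) r
      refine ⟨w, Or.inr hw, v, Or.inl rfl, hvw.symm, ?_, by omega, ?_⟩
      · rw [hc' w hw (by omega), hcw]
      · rw [ht'v, mul_one, ht' w hw (by omega), Sym2.eq_swap, hs]
    · obtain ⟨u, hu, w, hw, huw, hcu, hcw, hs⟩ := h.pair a b hab (hidx' a (by omega))
        (by omega) r
      refine ⟨u, Or.inr hu, w, Or.inr hw, huw, ?_, ?_, ?_⟩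
      · rw [hc' u hu (by omega), hcu]
      · rw [hc' w hw (by omega), hcw]
      · rw [ht' u hu (by omega), ht' w hw (by omega), hs]

/-- Either some nonzero class misses a sign at `v`, and `v` fits into it after a suitable switching,
or `v` sees both signs at all nonzero classes, and the class `0` is created, enlarged or promoted.
-/
theorem PartialColouring.exists_insert (h : PartialColouring G σ k W c t) {v : V} (hv : v ∉ W) :
    ∃ k', k ≤ k' ∧ ∃ c' t', PartialColouring G σ k' (insert v W) c' t' := by
  by_cases h1 : ∃ i, 1 ≤ i ∧ i ≤ k / 2 ∧ ∃ s : ℤˣ, ∀ w ∈ W, G.Adj v w → c w = i →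
      σ s(v, w) * t w ≠ s
  · obtain ⟨i, hi, hik, s, hs⟩ := h1
    -- With `s` the missing sign, all edges from `v` to the class have sign `-s`; giving `v` the
    -- sign `s` makes them negative.
    refine ⟨k, le_rfl, h.insert_class hv ⟨hik, fun _ => by omega⟩ s fun w hw hvw hcw =>
      ⟨by omega, ?_⟩⟩
    rw [mul_right_comm, units_eq_neg_of_ne (hs w hw hvw hcw), neg_mul, Int.units_mul_self]
  · push Not at h1
    by_cases hk : Even k
    · exact ⟨k + 1, by omega, h.insert_zero hv hk h1⟩
    · by_cases h2 : ∃ x ∈ W, G.Adj v x ∧ c x = 0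
      · obtain ⟨x, hx, hvx, hcx⟩ := h2
        exact ⟨k + 1, by omega, h.insert_top hv hk h1 hx hvx hcx⟩
      · exact ⟨k, le_rfl, h.insert_class hv ⟨Nat.zero_le _, fun he => absurd he hk⟩ 1
          fun w hw hvw hcw => absurd ⟨w, hw, hvw, hcw⟩ h2⟩

theorem PartialColouring.exists_univ [Finite V] (h : PartialColouring G σ k W c t) :
    ∃ k', k ≤ k' ∧ ∃ c' t', PartialColouring G σ k' Set.univ c' t' := by
  have key : ∀ n : ℕ, ∀ (k : ℕ) (W : Set V) (c : V → ℕ) (t : V → ℤˣ), Wᶜ.ncard = n →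
      PartialColouring G σ k W c t →
      ∃ k', k ≤ k' ∧ ∃ c' t', PartialColouring G σ k' Set.univ c' t' := by
    intro n
    induction n with
    | zero =>
      intro k W c t hn h
      rw [Set.ncard_eq_zero, Set.compl_empty_iff] at hn
      exact ⟨k, le_rfl, c, t, hn ▸ h⟩
    | succ n ih =>
      intro k W c t hn h
      obtain ⟨v, hv⟩ := Set.nonempty_of_ncard_ne_zero (s := Wᶜ) (by omega)
      obtain ⟨k', hk', c', t', h'⟩ := h.exists_insert hv
      have hcard : (insert v W)ᶜ.ncard = n := by
        have : (insert v W)ᶜ = Wᶜ \ {v} := by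
          ext w; simp [not_or, and_comm]
        rw [this, Set.ncard_sdiff_singleton_of_mem hv, hn]
        rfl
      obtain ⟨k'', hk'', h''⟩ := ih k' _ c' t' hcard h'
      exact ⟨k'', hk'.trans hk'', h''⟩
  exact key _ k W c t rfl h

/-- The achromatic number is at least the one of every induced subgraph. -/
theorem PartialColouring.le_achromaticNumber_of_induced [Finite V]
    (h : PartialColouring G σ k W c t) : k ≤ achromaticNumber G σ := by
  obtain ⟨k', hk', c', t', h'⟩ := h.exists_univ
  exact hk'.trans h'.le_achromaticNumber

/-- Changing the presence of one edge lowers the achromatic number by at most two. -/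
theorem achromaticNumber_le_add_two [Finite V] {G' : SimpleGraph V} {e : Sym2 V}
    (hG : ∀ u v, s(u, v) ≠ e → (G.Adj u v ↔ G'.Adj u v)) :
    achromaticNumber G σ ≤ achromaticNumber G' σ + 2 := by
  induction e with
  | h x y =>
  rcases Nat.eq_zero_or_pos (achromaticNumber G σ) with h0 | h0
  · omega
  obtain ⟨c, t, h⟩ := exists_colouring_achromaticNumber h0
  have hle := fun v => (h.mem v trivial).1
  by_cases hx : c x = 0
  · by_cases hy : c y = 0
    -- As the class `0` is independent, this case arises only if `e` is not an edge of `G`. No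
    -- nonzero class meets `e`, but dropping the class `0` costs just one colour.
    · have hodd : ¬ Even (achromaticNumber G σ) := fun he => (h.mem x trivial).2 he hx
      have h' := (h.remove_zero hodd).congr_graph (G' := G') fun u hu v hv => hG u v fun he => by
        rcases Sym2.eq_iff.1 he with ⟨rfl, rfl⟩ | ⟨rfl, rfl⟩
        · exact hu.2 hx
        · exact hu.2 hy
      have := h'.le_achromaticNumber_of_induced
      omega
    · obtain ⟨c', h'⟩ := h.remove_class (Nat.pos_of_ne_zero hy) (hle y)
      have h' := h'.congr_graph (G' := G') fun u hu v hv => hG u v fun he => by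
        rcases Sym2.eq_iff.1 he with ⟨rfl, rfl⟩ | ⟨rfl, rfl⟩
        · exact hv.2 rfl
        · exact hu.2 rfl
      have := h'.le_achromaticNumber_of_induced
      omega
  · obtain ⟨c', h'⟩ := h.remove_class (Nat.pos_of_ne_zero hx) (hle x)
    have h' := h'.congr_graph (G' := G') fun u hu v hv => hG u v fun he => by
      rcases Sym2.eq_iff.1 he with ⟨rfl, rfl⟩ | ⟨rfl, rfl⟩
      · exact hu.2 rfl
      · exact hv.2 rfl
    have := h'.le_achromaticNumber_of_induced
    omega

theorem achromaticNumber_deleteEdges_le [Finite V] (G : SimpleGraph V) (σ : Sym2 V → ℤˣ)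
    (e : Sym2 V) : achromaticNumber (G.deleteEdges {e}) σ ≤ achromaticNumber G σ + 2 :=
  achromaticNumber_le_add_two (e := e) fun u v huv => by simp [huv]

theorem achromaticNumber_le_deleteEdges [Finite V] (G : SimpleGraph V) (σ : Sym2 V → ℤˣ)
    (e : Sym2 V) : achromaticNumber G σ ≤ achromaticNumber (G.deleteEdges {e}) σ + 2 :=
  achromaticNumber_le_add_two (e := e) fun u v huv => by simp [huv]

end


/-! ### Upper bounds from vertex covers -/

section

variable {V : Type*} {G : SimpleGraph V} {σ : Sym2 V → ℤˣ} {k : ℕ} {c : V → ℕ} {t : V → ℤˣ}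

/-- If all edges are negative and all other vertices in the classes of `a` and `b` are adjacent
to both `a` and `b`, then the classes of `a` and `b` agree. -/
theorem PartialColouring.eq_of_twins (h : PartialColouring G σ k Set.univ c t)
    (hσ : ∀ u v, G.Adj u v → σ s(u, v) = -1) {a b : V}
    (hab : ∀ x, x ≠ a → x ≠ b → c x = c a ∨ c x = c b → G.Adj a x ∧ G.Adj b x) :
    c a = c b := by
  by_contra hne
  have hsign : ∀ u v, G.Adj u v → c u = c v → t u = t v := by
    intro u v huv hc
    have := (h.inner u trivial v trivial huv hc).2
    rw [hσ u v huv, neg_one_mul, neg_mul, neg_inj] at this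
    rcases Int.units_eq_one_or (t u) with h1 | h1 <;>
      rcases Int.units_eq_one_or (t v) with h2 | h2 <;> simp_all
  have hta : ∀ x, c x = c a → t x = t a := by
    intro x hx
    by_cases hxa : x = a
    · rw [hxa]
    · exact (hsign a x (hab x hxa (fun he => hne (by rw [← hx, he])) (Or.inl hx)).1 hx.symm).symm
  have htb : ∀ x, c x = c b → t x = t b := by
    intro x hx
    by_cases hxb : x = b
    · rw [hxb]
    · exact (hsign b x (hab x (fun he => hne (by rw [← hx, he])) hxb (Or.inr hx)).2 hx.symm).symm
  -- Since `t` is constant on each of the two classes, every edge between them has sign `-(t a * t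
  -- b)`; the opposite sign is missing.
  obtain ⟨u, -, v, -, huv, hu, hv, hs⟩ :=
    h.pair_ne hne (h.mem a trivial) (h.mem b trivial) (t a * t b)
  rw [hσ u v huv, hta u hu, htb v hv, neg_one_mul, neg_mul] at hs
  rcases Int.units_eq_one_or (t a * t b) with h1 | h1 <;> simp [h1] at hs

open Classical in
/-- If the vertices outside `C` are independent, then every nonzero class meets `C`. -/
theorem PartialColouring.Icc_subset_image (h : PartialColouring G σ k Set.univ c t) {C : Finset V}
    (hC : ∀ u v, G.Adj u v → u ∈ C ∨ v ∈ C) : Finset.Icc 1 (k / 2) ⊆ C.image c := by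
  intro i hi
  rw [Finset.mem_Icc] at hi
  obtain ⟨u, -, v, -, huv, hu, hv⟩ := h.loop i hi.1 hi.2
  rw [Finset.mem_image]
  rcases hC u v huv with hm | hm
  · exact ⟨u, hm, hu⟩
  · exact ⟨v, hm, hv⟩

/-- Upper bound from a vertex cover in which two vertices have the same neighbours. -/
theorem PartialColouring.lt_of_cover (h : PartialColouring G σ k Set.univ c t)
    (hσ : ∀ u v, G.Adj u v → σ s(u, v) = -1) {C : Finset V}
    (hC : ∀ u v, G.Adj u v → u ∈ C ∨ v ∈ C) {a b : V} (ha : a ∈ C) (hb : b ∈ C) (hab : a ≠ b)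
    (hadj : ∀ x ∉ C, G.Adj a x ∧ G.Adj b x) : k < 2 * C.card := by
  classical
  by_contra hk
  have hsub := h.Icc_subset_image hC
  have h1 := Finset.card_le_card hsub
  rw [Nat.card_Icc] at h1
  -- At least `|C|` nonzero classes meet `C`, so each of them contains exactly one vertex of `C`;
  -- all else in the classes of `a` and `b` lies outside `C`.
  have hinj : Set.InjOn c C := Finset.card_image_iff.1
    (le_antisymm Finset.card_image_le (by omega))
  refine hab (hinj ha hb (h.eq_of_twins hσ fun x hxa hxb hx => hadj x fun hxC => ?_))
  rcases hx with hx | hx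
  · exact hxa (hinj hxC ha hx)
  · exact hxb (hinj hxC hb hx)

/-- Upper bound from a vertex cover `C` with two vertices adjacent to all others and a third one
that has only one neighbour outside `C`. -/
theorem PartialColouring.le_of_cover (h : PartialColouring G σ k Set.univ c t)
    (hσ : ∀ u v, G.Adj u v → σ s(u, v) = -1) {C : Finset V}
    (hC : ∀ u v, G.Adj u v → u ∈ C ∨ v ∈ C) {a b d : V} (ha : a ∈ C) (hb : b ∈ C) (hd : d ∈ C)
    (hab : a ≠ b) (hda : d ≠ a) (hdb : d ≠ b)
    (hadj : ∀ x, x ≠ a → x ≠ b → G.Adj a x ∧ G.Adj b x)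
    (hdeg : ∀ x ∉ C, ∀ y ∉ C, G.Adj d x → G.Adj d y → x = y) : k + 2 ≤ 2 * C.card := by
  classical
  by_contra hk
  have hcab : c a = c b := h.eq_of_twins hσ fun x hxa hxb _ => hadj x hxa hxb
  have himg : C.image c = (C.erase a).image c := by
    apply le_antisymm
    · intro i hi
      obtain ⟨x, hx, rfl⟩ := Finset.mem_image.1 hi
      by_cases hxa : x = a
      · exact Finset.mem_image.2 ⟨b, Finset.mem_erase.2 ⟨hab.symm, hb⟩, by rw [hxa, hcab]⟩
      · exact Finset.mem_image_of_mem c (Finset.mem_erase.2 ⟨hxa, hx⟩)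
    · exact Finset.image_subset_image (Finset.erase_subset _ _)
  have hsub := himg ▸ h.Icc_subset_image hC
  have hcard := Finset.card_erase_of_mem ha
  have hle := Finset.card_image_le (s := C.erase a) (f := c)
  have hpos : 0 < C.card := Finset.card_pos.2 ⟨a, ha⟩
  have h1 := Finset.card_le_card hsub
  have h1' := Nat.card_Icc 1 (k / 2)
  -- The merged class of `a` and `b` leaves at most `|C| - 1` nonzero classes. So only `k = 2|C| -
  -- 1` must be excluded, where the nonzero classes correspond to `C.erase a` and the class `0`
  -- avoids `C`.
  have heq := Finset.eq_of_subset_of_card_le hsub (by omega)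
  have hinj : Set.InjOn c (C.erase a : Finset V) := Finset.card_image_iff.1 (by omega)
  have hne0 : ∀ x ∈ C, c x ≠ 0 := by
    intro x hx
    have : c x ∈ Finset.Icc 1 (k / 2) := by
      rw [heq, ← himg]
      exact Finset.mem_image_of_mem c hx
    rw [Finset.mem_Icc] at this
    omega
  have hdc : ∀ x ∈ C, c x = c d → x = d := by
    intro x hx hxd
    have hdm : d ∈ C.erase a := Finset.mem_erase.2 ⟨hda, hd⟩
    by_cases hxa : x = a
    · refine absurd (hinj (Finset.mem_coe.2 (Finset.mem_erase.2 ⟨hab.symm, hb⟩))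
        (Finset.mem_coe.2 hdm) ?_) hdb.symm
      rw [← hcab, ← hxa, hxd]
    · exact hinj (Finset.mem_coe.2 (Finset.mem_erase.2 ⟨hxa, hx⟩)) (Finset.mem_coe.2 hdm) hxd
  have hodd : ¬ Even k := by rw [Nat.even_iff]; omega
  have hzero : IsIndex k 0 := ⟨Nat.zero_le _, fun he => absurd he hodd⟩
  -- An edge between the class `0` and the class of `d` has an end in `C`, and this can only be `d`.
  -- Both signs would then require two neighbours of `d` outside `C`.
  have hedge : ∀ s : ℤˣ, ∃ u ∉ C, G.Adj d u ∧ σ s(u, d) * t u * t d = s := by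
    intro s
    obtain ⟨u, -, v, -, huv, hu, hv, hs⟩ := h.pair_ne (hne0 d hd).symm hzero (h.mem d trivial) s
    have huC : u ∉ C := fun huC => hne0 u huC hu
    have hvd : v = d := hdc v ((hC u v huv).resolve_left huC) hv
    subst hvd
    exact ⟨u, huC, huv.symm, hs⟩
  obtain ⟨u, hu, hdu, hs⟩ := hedge 1
  obtain ⟨u', hu', hdu', hs'⟩ := hedge (-1)
  rw [hdeg u hu u' hu' hdu hdu', hs'] at hs
  exact absurd hs (by decide)

end

/-! ### Invariance under relabelling -/

/-- Relabelling the vertices does not change the complete colourings. -/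
theorem PartialColouring.comap {V W : Type*} {G : SimpleGraph V} {σ : Sym2 V → ℤˣ} {k : ℕ}
    {c : V → ℕ} {t : V → ℤˣ} (h : PartialColouring G σ k Set.univ c t) (f : W ≃ V) :
    PartialColouring (G.comap f) (σ ∘ Sym2.map f) k Set.univ (c ∘ f) (t ∘ f) where
  mem v _ := h.mem (f v) trivial
  surj i hi := by
    obtain ⟨v, -, hv⟩ := h.surj i hi
    exact ⟨f.symm v, trivial, by simpa using hv⟩
  inner u _ v _ huv hc := h.inner (f u) trivial (f v) trivial huv hc
  loop i hi hik := by
    obtain ⟨u, -, v, -, huv⟩ := h.loop i hi hik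
    exact ⟨f.symm u, trivial, f.symm v, trivial, by simpa using huv⟩
  pair i j hij hi hj s := by
    obtain ⟨u, -, v, -, huv⟩ := h.pair i j hij hi hj s
    exact ⟨f.symm u, trivial, f.symm v, trivial, by simpa using huv⟩

theorem achromaticNumber_comap_aux {V W : Type*} [Finite W] (G : SimpleGraph V)
    (σ : Sym2 V → ℤˣ) (f : W ≃ V) :
    achromaticNumber G σ ≤ achromaticNumber (G.comap f) (σ ∘ Sym2.map f) :=
  achromaticNumber_le fun _ _ _ h => (h.comap f).le_achromaticNumber

theorem achromaticNumber_comap {V W : Type*} [Finite V] [Finite W] (G : SimpleGraph V)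
    (σ : Sym2 V → ℤˣ) (f : W ≃ V) :
    achromaticNumber (G.comap f) (σ ∘ Sym2.map f) = achromaticNumber G σ := by
  refine le_antisymm ?_ (achromaticNumber_comap_aux G σ f)
  have := achromaticNumber_comap_aux (G.comap f) (σ ∘ Sym2.map f) f.symm
  rw [SimpleGraph.comap_comap, Function.comp_assoc, Sym2.map_comp.symm] at this
  simpa using this

theorem comap_deleteEdges {V W : Type*} (G : SimpleGraph V) (f : W ≃ V) (e : Sym2 W) :
    (G.deleteEdges {e.map f}).comap f = (G.comap f).deleteEdges {e} := by
  ext u v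
  have : s(f u, f v) = e.map f ↔ s(u, v) = e := by
    rw [← Sym2.map_mk]
    exact (Sym2.map.injective f.injective).eq_iff
  simp [this]

/-- Examples on a finite vertex set may be assumed to have vertices `0, …, n - 1`. -/
theorem exists_fin_of_exists {V : Type*} [Finite V] {G : SimpleGraph V} {σ : Sym2 V → ℤˣ}
    {e : Sym2 V} (he : e ∈ G.edgeSet) :
    ∃ (n : ℕ) (G' : SimpleGraph (Fin n)) (σ' : Sym2 (Fin n) → ℤˣ), ∃ e' ∈ G'.edgeSet,
      achromaticNumber G' σ' = achromaticNumber G σ ∧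
      achromaticNumber (G'.deleteEdges {e'}) σ' = achromaticNumber (G.deleteEdges {e}) σ := by
  obtain ⟨n, ⟨f⟩⟩ := Finite.exists_equiv_fin V
  have hmap : (e.map f).map f.symm = e := by
    rw [Sym2.map_map]
    simp
  refine ⟨n, G.comap f.symm, σ ∘ Sym2.map f.symm, e.map f, ?_, achromaticNumber_comap G σ f.symm,
    ?_⟩
  · induction e with
    | h x y => simpa using he
  · rw [← comap_deleteEdges, hmap, achromaticNumber_comap]


/-! ### The graphs `H_p` -/

theorem isIndex_two_mul {n i : ℕ} : IsIndex (2 * n) i ↔ 1 ≤ i ∧ i ≤ n := by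
  simp only [IsIndex, even_two_mul, true_imp_iff]
  omega

/-- Given a complete `2n`-colouring in which every class has a vertex in `K`, a complete
`2(n + 1)`-colouring is obtained by adding a class of three vertices joined to `K`, of which
two are adjacent. -/
theorem PartialColouring.sum_fin_three {V : Type*} {G : SimpleGraph V} {σ : Sym2 V → ℤˣ} {n : ℕ}
    {c : V → ℕ} {t : V → ℤˣ} (h : PartialColouring G σ (2 * n) Set.univ c t) {K : V → Prop}
    (hK : ∀ i, 1 ≤ i → i ≤ n → ∃ v, K v ∧ c v = i)
    {G' : SimpleGraph (V ⊕ Fin 3)} {σ' : Sym2 (V ⊕ Fin 3) → ℤˣ}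
    (hll : ∀ u v, G'.Adj (Sum.inl u) (Sum.inl v) ↔ G.Adj u v)
    (hlr : ∀ u i, G'.Adj (Sum.inl u) (Sum.inr i) ↔ K u)
    (hrr : ∀ i j, G'.Adj (Sum.inr i) (Sum.inr j) ↔ (i = 1 ∧ j = 2) ∨ (j = 1 ∧ i = 2))
    (hσ : ∀ u v, σ' s(Sum.inl u, Sum.inl v) = σ s(u, v))
    (hσ' : ∀ x i, σ' s(x, Sum.inr i) = -1) :
    PartialColouring G' σ' (2 * (n + 1)) Set.univ (Sum.elim c fun _ => n + 1)
      (Sum.elim t ![-1, 1, 1]) := by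
  have hmem : ∀ v, 1 ≤ c v ∧ c v ≤ n := fun v => isIndex_two_mul.1 (h.mem v trivial)
  have h12 : G'.Adj (Sum.inr 1) (Sum.inr 2) := by simp [hrr]
  constructor
  · rintro (v | i) -
    · have := hmem v
      exact isIndex_two_mul.2 ⟨this.1, by simp only [Sum.elim_inl]; omega⟩
    · exact isIndex_two_mul.2 ⟨by simp, by simp⟩
  · intro i hi
    rw [isIndex_two_mul] at hi
    by_cases hin : i = n + 1
    · exact ⟨Sum.inr 0, trivial, hin.symm⟩
    · obtain ⟨v, -, hv⟩ := hK i hi.1 (by omega)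
      exact ⟨Sum.inl v, trivial, by assumption⟩
  · rintro (u | i) - (v | j) - huv hc
    · rw [hσ]
      exact h.inner u trivial v trivial ((hll u v).1 huv) hc
    · have := hmem u
      simp only [Sum.elim_inl, Sum.elim_inr] at hc
      omega
    · have := hmem v
      simp only [Sum.elim_inl, Sum.elim_inr] at hc
      omega
    · rw [hσ']
      refine ⟨by simp, ?_⟩
      rcases (hrr i j).1 huv with ⟨rfl, rfl⟩ | ⟨rfl, rfl⟩ <;> simp
  · intro i hi hin
    by_cases hin' : i = n + 1
    · exact ⟨Sum.inr 1, trivial, Sum.inr 2, trivial, h12, hin'.symm, hin'.symm⟩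
    · obtain ⟨u, -, v, -, huv, hu, hv⟩ := h.loop i hi (by omega)
      exact ⟨Sum.inl u, trivial, Sum.inl v, trivial, (hll u v).2 huv, hu, hv⟩
  · intro i j hij hi hj s
    rw [isIndex_two_mul] at hi
    by_cases hjn : j = n + 1
    · obtain ⟨v, hv, rfl⟩ := hK i hi.1 (by omega)
      -- The new vertices `0` and `1` have opposite values of `t`, so a vertex of `K` sees both
      -- signs. The vertices `1` and `2` agree, which keeps the edge between them negative.
      by_cases hs : s = t v
      · refine ⟨Sum.inl v, trivial, Sum.inr 0, trivial, (hlr v 0).2 hv, rfl, hjn.symm, ?_⟩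
        simp [hσ', hs]
      · refine ⟨Sum.inl v, trivial, Sum.inr 1, trivial, (hlr v 1).2 hv, rfl, hjn.symm, ?_⟩
        simp [hσ', units_eq_neg_of_ne hs]
    · obtain ⟨u, -, v, -, huv, hu, hv, hs⟩ :=
        h.pair i j hij (isIndex_two_mul.2 ⟨hi.1, by omega⟩) (by omega) s
      exact ⟨Sum.inl u, trivial, Sum.inl v, trivial, (hll u v).2 huv, hu, hv, by
        rw [hσ]; exact hs⟩

instance instFiniteFamilyVertex : (q : ℕ) → Finite (FamilyVertex q)
  | 0 => inferInstanceAs (Finite (Fin 8))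
  | q + 1 =>
    have := instFiniteFamilyVertex q
    inferInstanceAs (Finite (FamilyVertex q ⊕ Fin 3))

theorem cliqueFamily_zero_adj (i j : Fin 8) : (cliqueFamily 0).Adj i j ↔
    i ≠ j ∧ ((i < j ∧ (i < 2 ∨ (i = 2 ∧ j = 7))) ∨ (j < i ∧ (j < 2 ∨ (j = 2 ∧ i = 7)))) :=
  Iff.rfl

theorem cliqueFamily_inl_inl {q : ℕ} (u v : FamilyVertex q) :
    (cliqueFamily (q + 1)).Adj (Sum.inl u) (Sum.inl v) ↔ (cliqueFamily q).Adj u v := by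
  change (Sum.inl u : FamilyVertex q ⊕ Fin 3) ≠ Sum.inl v ∧ (FamilyRel q u v ∨ FamilyRel q v u) ↔
    u ≠ v ∧ (FamilyRel q u v ∨ FamilyRel q v u)
  rw [Sum.inl_injective.ne_iff]

theorem cliqueFamily_inl_inr {q : ℕ} (u : FamilyVertex q) (i : Fin 3) :
    (cliqueFamily (q + 1)).Adj (Sum.inl u) (Sum.inr i) ↔ IsCore q u := by
  change (Sum.inl u : FamilyVertex q ⊕ Fin 3) ≠ Sum.inr i ∧ (IsCore q u ∨ False) ↔ IsCore q u
  simp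

theorem cliqueFamily_inr_inr {q : ℕ} (i j : Fin 3) :
    (cliqueFamily (q + 1)).Adj (Sum.inr i) (Sum.inr j) ↔
      (i = 1 ∧ j = 2) ∨ (j = 1 ∧ i = 2) := by
  change (Sum.inr i : FamilyVertex q ⊕ Fin 3) ≠ Sum.inr j ∧
    ((i = 1 ∧ j = 2) ∨ (j = 1 ∧ i = 2)) ↔ _
  rw [Sum.inr_injective.ne_iff]
  revert i j
  decide

theorem baseVertex_injective : ∀ q, Function.Injective (baseVertex q)
  | 0 => fun _ _ h => h
  | q + 1 => fun _ _ h => baseVertex_injective q (Sum.inl_injective h)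

/-- Complete colourings of `H_3` lift to the graphs `H_p`, also for modified graphs and
signatures. -/
theorem exists_colouring_cliqueFamily (G : ∀ q, SimpleGraph (FamilyVertex q))
    (σ : ∀ q, Sym2 (FamilyVertex q) → ℤˣ)
    (h0 : ∃ c t, PartialColouring (G 0) (σ 0) (2 * 3) Set.univ c t ∧
      ∀ i, 1 ≤ i → i ≤ 3 → ∃ v, IsCore 0 v ∧ c v = i)
    (hll : ∀ q u v, (G (q + 1)).Adj (Sum.inl u) (Sum.inl v) ↔ (G q).Adj u v)
    (hlr : ∀ q u i, (G (q + 1)).Adj (Sum.inl u) (Sum.inr i) ↔ IsCore q u)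
    (hrr : ∀ q i j, (G (q + 1)).Adj (Sum.inr i) (Sum.inr j) ↔
      (i = 1 ∧ j = 2) ∨ (j = 1 ∧ i = 2))
    (hσ : ∀ q u v, σ (q + 1) s(Sum.inl u, Sum.inl v) = σ q s(u, v))
    (hσ' : ∀ q x i, σ (q + 1) s(x, Sum.inr i) = -1) (q : ℕ) :
    ∃ c t, PartialColouring (G q) (σ q) (2 * (q + 3)) Set.univ c t ∧
      ∀ i, 1 ≤ i → i ≤ q + 3 → ∃ v, IsCore q v ∧ c v = i := by
  induction q with
  | zero => exact h0
  | succ q ih =>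
    obtain ⟨c, t, h, hK⟩ := ih
    have h' := h.sum_fin_three hK (G' := G (q + 1)) (σ' := σ (q + 1)) (hll q) (hlr q) (hrr q)
      (hσ q) (hσ' q)
    refine ⟨_, _, by rw [Nat.add_right_comm]; exact h', fun i hi hiq => ?_⟩
    by_cases hi' : i = q + 3 + 1
    · exact ⟨Sum.inr 1, rfl, hi'.symm⟩
    · obtain ⟨v, hv, hcv⟩ := hK i hi (by omega)
      exact ⟨Sum.inl v, hv, hcv⟩

/-- A criterion for complete `2n`-colourings of graphs with decidable data. -/
theorem PartialColouring.of_decidable {m n : ℕ} {G : SimpleGraph (Fin m)} {σ : Sym2 (Fin m) → ℤˣ}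
    {D : Fin m → Fin m → Prop} {S : Fin m → Fin m → ℤˣ} {c : Fin m → ℕ} {t : Fin m → ℤˣ}
    (hadj : ∀ u v, G.Adj u v ↔ D u v) (hσ : ∀ u v, σ s(u, v) = S u v)
    (hmem : ∀ v, 1 ≤ c v ∧ c v ≤ n)
    (hinner : ∀ u v, D u v → c u = c v → S u v * t u * t v = -1)
    (hloop : ∀ i < n, ∃ u v, D u v ∧ c u = i + 1 ∧ c v = i + 1)
    (hpair : ∀ j < n, ∀ i < j, ∀ s, ∃ u v, D u v ∧ c u = i + 1 ∧ c v = j + 1 ∧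
      S u v * t u * t v = s) :
    PartialColouring G σ (2 * n) Set.univ c t where
  mem v _ := isIndex_two_mul.2 (hmem v)
  surj i hi := by
    rw [isIndex_two_mul] at hi
    obtain ⟨u, _, _, hu, _⟩ := hloop (i - 1) (by omega)
    exact ⟨u, trivial, by omega⟩
  inner u _ v _ huv hc := by
    rw [hσ]
    exact ⟨by have := hmem u; omega, hinner u v ((hadj u v).1 huv) hc⟩
  loop i h1 h2 := by
    obtain ⟨u, v, huv, hu, hv⟩ := hloop (i - 1) (by omega)
    exact ⟨u, trivial, v, trivial, (hadj u v).2 huv, by omega, by omega⟩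
  pair i j hij hi hj s := by
    rw [isIndex_two_mul] at hi
    obtain ⟨u, v, huv, hu, hv, hs⟩ := hpair (j - 1) (by omega) (i - 1) (by omega) s
    exact ⟨u, trivial, v, trivial, (hadj u v).2 huv, by omega, by omega, by rw [hσ, hs]⟩

set_option synthInstance.maxSize 1000 in
set_option synthInstance.maxHeartbeats 200000 in
/-- A complete `6`-colouring of `H_3 - k_1 v_1` with all edges negative. -/
theorem colouring_deleteEdges_base :
    PartialColouring (V := Fin 8) ((cliqueFamily 0).deleteEdges {familyEdge 0})
      (allNegative (FamilyVertex 0)) (2 * 3) Set.univ ![1, 2, 3, 1, 1, 2, 3, 3]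
      ![1, 1, 1, -1, 1, 1, -1, 1] := by
  -- The classes are `{k_1, v_1, v_2}`, `{k_2, v_3}`, `{k_3, v_4, w_3}`, with `v_1` and `v_4`
  -- switched. Then `v_1 k_2`, `k_1 v_4`, `k_2 v_4` are the positive edges between classes; the
  -- deleted edge `k_1 v_1` would be positive inside its class.
  refine PartialColouring.of_decidable (S := fun _ _ => -1)
    (D := fun u v : Fin 8 => (u ≠ v ∧ ((u < v ∧ (u < 2 ∨ (u = 2 ∧ v = 7))) ∨
      (v < u ∧ (v < 2 ∨ (v = 2 ∧ u = 7))))) ∧ ¬ ((u = 0 ∧ v = 3) ∨ (u = 3 ∧ v = 0)))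
    (fun u v => SimpleGraph.deleteEdges_adj.trans (and_congr (cliqueFamily_zero_adj u v)
      (not_congr (Set.mem_singleton_iff.trans Sym2.eq_iff)))) (fun _ _ => rfl) ?_ ?_ ?_ ?_
  all_goals decide

open Classical in
/-- The signature in which only the edge `e` is positive. -/
noncomputable def positiveAt {V : Type*} (e : Sym2 V) : Sym2 V → ℤˣ :=
  fun x => if x = e then 1 else -1

theorem positiveAt_eq_ite {V : Type*} {e x : Sym2 V} {p : Prop} [Decidable p] (h : x = e ↔ p) :
    positiveAt e x = if p then 1 else -1 := by
  by_cases hp : p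
  · rw [if_pos hp, positiveAt, if_pos (h.2 hp)]
  · rw [if_neg hp, positiveAt, if_neg fun he => hp (h.1 he)]

set_option synthInstance.maxSize 1000 in
set_option synthInstance.maxHeartbeats 200000 in
/-- A complete `6`-colouring of `H_3` with all edges but `k_1 k_2` negative. -/
theorem colouring_positiveAt_base :
    PartialColouring (V := Fin 8) (cliqueFamily 0)
      (positiveAt (V := Fin 8) s(0, 1)) (2 * 3) Set.univ ![1, 2, 3, 1, 1, 2, 3, 3]
      ![1, 1, 1, 1, 1, 1, -1, 1] := by
  -- The classes are those used for `H_3 - k_1 v_1`, but `v_1` is not switched: the positive edge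
  -- `k_1 k_2` now replaces `v_1 k_2`, and `k_1 v_1` stays negative.
  refine PartialColouring.of_decidable cliqueFamily_zero_adj
    (S := fun u v => if (u = 0 ∧ v = 1) ∨ (u = 1 ∧ v = 0) then 1 else -1)
    (fun u v => positiveAt_eq_ite Sym2.eq_iff) ?_ ?_ ?_ ?_
  all_goals decide

theorem exists_isCore_base (c : Fin 8 → ℕ) (h0 : c 0 = 1) (h1 : c 1 = 2) (h2 : c 2 = 3) (i : ℕ)
    (hi : 1 ≤ i) (hi' : i ≤ 3) : ∃ v, IsCore 0 v ∧ c v = i := by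
  interval_cases i
  · exact ⟨(0 : Fin 8), show (0 : Fin 8) < 3 by decide, h0⟩
  · exact ⟨(1 : Fin 8), show (1 : Fin 8) < 3 by decide, h1⟩
  · exact ⟨(2 : Fin 8), show (2 : Fin 8) < 3 by decide, h2⟩

theorem mk_inl_eq_baseVertex {q : ℕ} {a b : Fin 8} {u v : FamilyVertex q} :
    ((s(Sum.inl u, Sum.inl v) : Sym2 (FamilyVertex (q + 1))) =
      s(baseVertex (q + 1) a, baseVertex (q + 1) b)) ↔
      s(u, v) = s(baseVertex q a, baseVertex q b) := by
  change s(Sum.inl u, Sum.inl v) = s(Sum.inl (baseVertex q a), Sum.inl (baseVertex q b)) ↔ _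
  rw [Sym2.eq_iff, Sym2.eq_iff]
  simp only [Sum.inl.injEq]

theorem mk_inr_ne_baseVertex {q : ℕ} {a b : Fin 8} {x : FamilyVertex (q + 1)} {i : Fin 3} :
    (s(x, Sum.inr i) : Sym2 (FamilyVertex (q + 1))) ≠
      s(baseVertex (q + 1) a, baseVertex (q + 1) b) := by
  intro h
  rcases Sym2.eq_iff.1 h with ⟨-, h⟩ | ⟨-, h⟩ <;> exact absurd h (by simp [baseVertex])

theorem le_achromaticNumber_deleteEdges_familyEdge (q : ℕ) : 2 * (q + 3) ≤
    achromaticNumber ((cliqueFamily q).deleteEdges {familyEdge q}) (allNegative _) := by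
  obtain ⟨c, t, h, -⟩ := exists_colouring_cliqueFamily
    (fun q => (cliqueFamily q).deleteEdges {familyEdge q}) (fun q => allNegative _)
    ⟨_, _, colouring_deleteEdges_base, exists_isCore_base _ rfl rfl rfl⟩
    (fun q u v => SimpleGraph.deleteEdges_adj.trans ((and_congr (cliqueFamily_inl_inl u v)
      (not_congr mk_inl_eq_baseVertex)).trans
        (SimpleGraph.deleteEdges_adj (G := cliqueFamily q) (s := {familyEdge q})).symm))
    (fun q u i => SimpleGraph.deleteEdges_adj.trans ((and_iff_left mk_inr_ne_baseVertex).trans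
      (cliqueFamily_inl_inr u i)))
    (fun q i j => SimpleGraph.deleteEdges_adj.trans ((and_iff_left mk_inr_ne_baseVertex).trans
      (cliqueFamily_inr_inr i j)))
    (fun _ _ _ => rfl) (fun _ _ _ => rfl) q
  exact h.le_achromaticNumber

theorem le_achromaticNumber_positiveAt (q : ℕ) : 2 * (q + 3) ≤
    achromaticNumber (cliqueFamily q) (positiveAt s(baseVertex q 0, baseVertex q 1)) := by
  obtain ⟨c, t, h, -⟩ := exists_colouring_cliqueFamily cliqueFamily
    (fun q => positiveAt s(baseVertex q 0, baseVertex q 1))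
    ⟨_, _, colouring_positiveAt_base, exists_isCore_base _ rfl rfl rfl⟩
    (fun _ => cliqueFamily_inl_inl) (fun _ => cliqueFamily_inl_inr)
    (fun _ => cliqueFamily_inr_inr)
    (fun q u v => by
      classical
      exact (positiveAt_eq_ite mk_inl_eq_baseVertex).trans (positiveAt_eq_ite Iff.rfl).symm)
    (fun q x i => if_neg mk_inr_ne_baseVertex) q
  exact h.le_achromaticNumber

/-- The vertices `k_1, …, k_{q+3}` of `H_{q+3}`. -/
def core : (q : ℕ) → Finset (FamilyVertex q)
  | 0 => ({0, 1, 2} : Finset (Fin 8))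
  | q + 1 => (core q).disjSum ({1} : Finset (Fin 3))

theorem card_core (q : ℕ) : (core q).card = q + 3 := by
  induction q with
  | zero => rfl
  | succ q ih =>
    change ((core q).disjSum ({1} : Finset (Fin 3))).card = _
    rw [Finset.card_disjSum, ih, Finset.card_singleton]

theorem mem_core {q : ℕ} {v : FamilyVertex q} : v ∈ core q ↔ IsCore q v := by
  induction q with
  | zero =>
    revert v
    change ∀ v : Fin 8, v ∈ ({0, 1, 2} : Finset (Fin 8)) ↔ v < 3
    decide
  | succ q ih =>
    change v ∈ (core q).disjSum ({1} : Finset (Fin 3)) ↔ _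
    rcases v with v | i
    · exact Finset.inl_mem_disjSum.trans ih
    · exact Finset.inr_mem_disjSum.trans Finset.mem_singleton

theorem core_cover {q : ℕ} {u v : FamilyVertex q} (h : (cliqueFamily q).Adj u v) :
    u ∈ core q ∨ v ∈ core q := by
  rw [mem_core, mem_core]
  induction q with
  | zero =>
    have h := (cliqueFamily_zero_adj u v).1 h
    revert u v
    change ∀ u v : Fin 8, _ → _ → u < 3 ∨ v < 3
    simp only [cliqueFamily_zero_adj]
    decide
  | succ q ih =>
    rcases u with u | i <;> rcases v with v | j
    · exact ih (cliqueFamily_inl_inl u v |>.1 h)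
    · exact Or.inl ((cliqueFamily_inl_inr u j).1 h)
    · exact Or.inr ((cliqueFamily_inl_inr v i).1 h.symm)
    · rcases (cliqueFamily_inr_inr i j).1 h with ⟨h, -⟩ | ⟨h, -⟩
      · exact Or.inl h
      · exact Or.inr h

theorem baseVertex_isCore (q : ℕ) {a : Fin 8} (ha : a < 3) : IsCore q (baseVertex q a) := by
  induction q with
  | zero => exact ha
  | succ q ih => exact ih

theorem baseVertex_adj (q : ℕ) {a : Fin 8} (ha : a < 2) {x : FamilyVertex q}
    (hx : x ≠ baseVertex q a) : (cliqueFamily q).Adj (baseVertex q a) x := by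
  induction q with
  | zero =>
    refine (cliqueFamily_zero_adj _ _).2 ?_
    change x ≠ a at hx
    revert x a
    change ∀ a : Fin 8, a < 2 → ∀ x : Fin 8, x ≠ a →
      a ≠ x ∧ ((a < x ∧ (a < 2 ∨ (a = 2 ∧ x = 7))) ∨ (x < a ∧ (x < 2 ∨ (x = 2 ∧ a = 7))))
    decide
  | succ q ih =>
    rcases x with x | i
    · exact (cliqueFamily_inl_inl _ _).2 (ih fun h => hx (by rw [h]; rfl))
    · exact (cliqueFamily_inl_inr _ i).2 (baseVertex_isCore q (ha.trans (by decide)))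

/-- The vertex `k_{q+3}` of `H_{q+3}`. -/
def lastCore : (q : ℕ) → FamilyVertex q
  | 0 => (2 : Fin 8)
  | _ + 1 => Sum.inr 1

theorem lastCore_mem (q : ℕ) : lastCore q ∈ core q := by
  rw [mem_core]
  cases q with
  | zero => exact show (2 : Fin 8) < 3 by decide
  | succ q => exact rfl

theorem lastCore_ne (q : ℕ) {a : Fin 8} (ha : a < 2) : lastCore q ≠ baseVertex q a := by
  cases q with
  | zero =>
    revert a
    change ∀ a : Fin 8, a < 2 → (2 : Fin 8) ≠ a
    decide
  | succ q => exact Sum.inr_ne_inl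

/-- Every step joins the earlier `k_i` to new vertices outside the core; only the last `k_p` still
has `w_p` as its sole neighbour there. It plays the role of `d` in `PartialColouring.le_of_cover`.
-/
theorem lastCore_adj_unique {q : ℕ} {x y : FamilyVertex q} (hx : x ∉ core q) (hy : y ∉ core q)
    (hdx : (cliqueFamily q).Adj (lastCore q) x) (hdy : (cliqueFamily q).Adj (lastCore q) y) :
    x = y := by
  rw [mem_core] at hx hy
  cases q with
  | zero =>
    have key : ∀ x : Fin 8, ¬ x < 3 → (cliqueFamily 0).Adj (2 : Fin 8) x → x = 7 := by
      simp only [cliqueFamily_zero_adj]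
      decide
    exact (key x hx hdx).trans (key y hy hdy).symm
  | succ q =>
    have key : ∀ x, ¬ IsCore (q + 1) x → (cliqueFamily (q + 1)).Adj (Sum.inr 1) x →
        x = Sum.inr 2 := by
      rintro (u | i) hu h
      · exact absurd ((cliqueFamily_inl_inr u 1).1 h.symm) hu
      · rcases (cliqueFamily_inr_inr 1 i).1 h with ⟨-, rfl⟩ | ⟨-, h⟩
        · rfl
        · exact absurd h (by decide)
    exact (key x hx hdx).trans (key y hy hdy).symm

/-- The core is a vertex cover of size `p = q + 3`, with twins `k_1`, `k_2`. Their mutual adjacency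
is irrelevant, so the bound covers both `H_p` and `H_p - k_1 k_2`. -/
theorem achromaticNumber_le_of_le_cliqueFamily {q : ℕ} {G : SimpleGraph (FamilyVertex q)}
    {σ : Sym2 (FamilyVertex q) → ℤˣ} (hG : G ≤ cliqueFamily q)
    (hσ : ∀ u v, G.Adj u v → σ s(u, v) = -1)
    (hadj : ∀ x, x ≠ baseVertex q 0 → x ≠ baseVertex q 1 →
      G.Adj (baseVertex q 0) x ∧ G.Adj (baseVertex q 1) x) :
    achromaticNumber G σ ≤ 2 * (q + 3) - 2 := by
  refine achromaticNumber_le fun k c t h => ?_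
  have := h.le_of_cover hσ (C := core q) (fun u v huv => core_cover (hG huv))
    (mem_core.2 (baseVertex_isCore q (a := 0) (by decide)))
    (mem_core.2 (baseVertex_isCore q (a := 1) (by decide))) (lastCore_mem q)
    ((baseVertex_injective q).ne (by decide)) (lastCore_ne q (by decide))
    (lastCore_ne q (by decide)) hadj
    (fun x hx y hy hdx hdy => lastCore_adj_unique hx hy (hG hdx) (hG hdy))
  rw [card_core] at this
  omega

theorem familyEdge_mem (q : ℕ) : familyEdge q ∈ (cliqueFamily q).edgeSet :=
  baseVertex_adj q (by decide) ((baseVertex_injective q).ne (by decide))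

/-- The achromatic numbers of `(H_p, -)` and `(H_p - k_1 v_1, -)`. -/
theorem achromaticNumber_cliqueFamily (q : ℕ) :
    achromaticNumber (cliqueFamily q) (allNegative _) = 2 * (q + 3) - 2 ∧
      achromaticNumber ((cliqueFamily q).deleteEdges {familyEdge q}) (allNegative _) =
        2 * (q + 3) := by
  have h1 := achromaticNumber_le_of_le_cliqueFamily (σ := allNegative _) (le_refl (cliqueFamily q))
    (fun _ _ _ => rfl) fun x h0 h1 => ⟨baseVertex_adj q (by decide) h0,
      baseVertex_adj q (by decide) h1⟩
  have h2 := le_achromaticNumber_deleteEdges_familyEdge q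
  have h3 := achromaticNumber_deleteEdges_le (cliqueFamily q) (allNegative _) (familyEdge q)
  omega

/-- Without its only positive edge the graph is all-negative, and `k_1`, `k_2` remain adjacent to
all other vertices. This gives the sharpness of the lower bound for even values. -/
theorem achromaticNumber_positiveAt (q : ℕ) :
    achromaticNumber (cliqueFamily q) (positiveAt s(baseVertex q 0, baseVertex q 1)) =
        2 * (q + 3) ∧
      achromaticNumber ((cliqueFamily q).deleteEdges {s(baseVertex q 0, baseVertex q 1)})
        (positiveAt s(baseVertex q 0, baseVertex q 1)) = 2 * (q + 3) - 2 := by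
  have h1 := achromaticNumber_le_of_le_cliqueFamily (q := q)
    (σ := positiveAt s(baseVertex q 0, baseVertex q 1))
    (SimpleGraph.deleteEdges_le {s(baseVertex q 0, baseVertex q 1)})
    (fun u v huv => if_neg (SimpleGraph.deleteEdges_adj.1 huv).2) fun x h0 h1 => by
      rw [SimpleGraph.deleteEdges_adj, SimpleGraph.deleteEdges_adj]
      refine ⟨⟨baseVertex_adj q (by decide) h0, ?_⟩, baseVertex_adj q (by decide) h1, ?_⟩
      · intro h
        rcases Sym2.eq_iff.1 h with ⟨-, h⟩ | ⟨h, h'⟩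
        · exact h1 h
        · exact h0 h'
      · intro h
        rcases Sym2.eq_iff.1 h with ⟨-, h⟩ | ⟨h, h'⟩
        · exact h1 h
        · exact h0 h'
  have h2 := le_achromaticNumber_positiveAt q
  have h3 := achromaticNumber_le_deleteEdges (cliqueFamily q)
    (positiveAt s(baseVertex q 0, baseVertex q 1)) s(baseVertex q 0, baseVertex q 1)
  omega


/-! ### Complete bipartite graphs minus a matching -/

theorem bipartiteMinusMatching_inl_inr {p : ℕ} (i : Fin p) (j : Fin (2 * p + 1)) :
    (bipartiteMinusMatching p).Adj (Sum.inl i) (Sum.inr j) ↔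
      ¬ (i.val = j.val ∧ 1 ≤ i.val ∧ i.val + 1 < p) := by
  rw [bipartiteMinusMatching, SimpleGraph.deleteEdges_adj]
  refine (and_iff_right (by simp)).trans (not_congr ?_)
  constructor
  · rintro ⟨i', j', he, h⟩
    rcases Sym2.eq_iff.1 he with ⟨h1, h2⟩ | ⟨h1, -⟩
    · rw [Sum.inl_injective h1, Sum.inr_injective h2]
      exact h
    · exact absurd h1 Sum.inl_ne_inr
  · intro h
    exact ⟨i, j, rfl, h⟩

theorem bipartiteMinusMatching_inl_inl {p : ℕ} (i j : Fin p) :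
    ¬ (bipartiteMinusMatching p).Adj (Sum.inl i) (Sum.inl j) := by
  simp [bipartiteMinusMatching]

theorem bipartiteMinusMatching_inr_inr {p : ℕ} (i j : Fin (2 * p + 1)) :
    ¬ (bipartiteMinusMatching p).Adj (Sum.inr i) (Sum.inr j) := by
  simp [bipartiteMinusMatching]

theorem isIndex_two_mul_add_one {n i : ℕ} : IsIndex (2 * n + 1) i ↔ i ≤ n := by
  have : ¬ Even (2 * n + 1) := by rw [Nat.even_iff]; omega
  simp only [IsIndex, this, false_imp_iff, and_true]
  omega

/-- There is a complete `(2p + 1)`-colouring of the complete bipartite graph minus the matching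
`u_i v_i`, `1 ≤ i < r`, in which all edges are negative, where `r = p` or there is a further
positive edge `u_0 u_{p-1}` and `r = p - 1`. -/
theorem le_achromaticNumber_bipartite {p r : ℕ} (hr : r ≤ p) (hr1 : 1 ≤ r) (hpr : p ≤ r + 1)
    {G : SimpleGraph (Fin p ⊕ Fin (2 * p + 1))} {σ : Sym2 (Fin p ⊕ Fin (2 * p + 1)) → ℤˣ}
    (hlr : ∀ i j, G.Adj (Sum.inl i) (Sum.inr j) ↔ ¬ (i.val = j.val ∧ 1 ≤ i.val ∧ i.val < r))
    (hrr : ∀ i j, ¬ G.Adj (Sum.inr i) (Sum.inr j))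
    (hσ : ∀ i j, σ s(Sum.inl i, Sum.inr j) = -1)
    (hpos : ∀ i j : Fin p, i.val = 0 → i < j → r ≤ j.val →
      G.Adj (Sum.inl i) (Sum.inl j) ∧ σ s(Sum.inl i, Sum.inl j) = 1) :
    2 * p + 1 ≤ achromaticNumber G σ := by
  -- With indices from `0`, the class `i + 1` consists of `u_i`, `v_{p+i}` and, for `i ≥ 1`, `v_i`;
  -- the class `0` is `{v_0, v_{2p}}`. Switching the `v_j` with `j < r` makes their edges positive,
  -- and the removed matching consists of exactly the edges that would then be positive inside a
  -- class. The vertices `v_p, …, v_{2p}` supply the negative edges, including those inside classes.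
  let c : Fin p ⊕ Fin (2 * p + 1) → ℕ := Sum.elim (fun i => i.val + 1) fun j =>
    if j.val = 0 then 0 else if j.val < p then j.val + 1 else
      if j.val < 2 * p then j.val - p + 1 else 0
  let t : Fin p ⊕ Fin (2 * p + 1) → ℤˣ := Sum.elim (fun _ => 1) fun j => if j.val < r then -1 else 1
  have hcl : ∀ i, c (Sum.inl i) = i.val + 1 := fun _ => rfl
  have hcr : ∀ j : Fin (2 * p + 1), c (Sum.inr j) = if j.val = 0 then 0 else
      if j.val < p then j.val + 1 else if j.val < 2 * p then j.val - p + 1 else 0 := fun _ => rfl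
  have htl : ∀ i, t (Sum.inl i) = 1 := fun _ => rfl
  have htr : ∀ j : Fin (2 * p + 1), t (Sum.inr j) = if j.val < r then -1 else 1 := fun _ => rfl
  have hsign : ∀ i (j : Fin (2 * p + 1)), σ s(Sum.inl i, Sum.inr j) * t (Sum.inl i) * t (Sum.inr j)
      = if j.val < r then 1 else -1 := by
    intro i j
    rw [hσ, htl, htr]
    split_ifs <;> rfl
  have hinner : ∀ i j, G.Adj (Sum.inl i) (Sum.inr j) → c (Sum.inl i) = c (Sum.inr j) →
      σ s(Sum.inl i, Sum.inr j) * t (Sum.inl i) * t (Sum.inr j) = -1 := by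
    intro i j hij hc
    rw [hlr] at hij
    rw [hcl, hcr] at hc
    rw [hsign, if_neg]
    split_ifs at hc <;> omega
  have hloop : ∀ i : Fin p, ∃ j : Fin (2 * p + 1), c (Sum.inr j) = i.val + 1 ∧ p ≤ j.val := by
    intro i
    refine ⟨⟨p + i.val, by omega⟩, ?_, by simp⟩
    rw [hcr, if_neg (by simp only; omega), if_neg (by simp), if_pos (by simp only; omega)]
    simp
  refine PartialColouring.le_achromaticNumber (c := c) (t := t)
    ⟨?_, fun i hi => ?_, ?_, fun i h1 h2 => ?_, fun i j hij hi hj s => ?_⟩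
  · rintro (i | j) -
    · rw [isIndex_two_mul_add_one, hcl]
      omega
    · rw [isIndex_two_mul_add_one, hcr]
      split_ifs <;> omega
  · rw [isIndex_two_mul_add_one] at hi
    rcases Nat.eq_zero_or_pos i with rfl | h
    · exact ⟨Sum.inr 0, trivial, by simp [hcr]⟩
    · exact ⟨Sum.inl ⟨i - 1, by omega⟩, trivial, by simp only [hcl]; omega⟩
  · rintro (i | i) - (j | j) - hij hc
    · rw [hcl, hcl] at hc
      exact absurd hij (by rw [Fin.ext (by omega : i.val = j.val)]; exact G.irrefl)
    · exact ⟨by rw [hcl]; omega, hinner i j hij hc⟩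
    · refine ⟨by rw [hc, hcl]; omega, ?_⟩
      rw [Sym2.eq_swap, mul_right_comm]
      exact hinner j i hij.symm hc.symm
    · exact absurd hij (hrr i j)
  · obtain ⟨j, hj, hpj⟩ := hloop ⟨i - 1, by omega⟩
    refine ⟨Sum.inl ⟨i - 1, by omega⟩, trivial, Sum.inr j, trivial, (hlr _ _).2 ?_, ?_, ?_⟩
    · simp only
      omega
    · simp only [hcl]
      omega
    · rw [hj]
      simp only
      omega
  · obtain ⟨j, rfl⟩ : ∃ j' : Fin p, j = j'.val + 1 := ⟨⟨j - 1, by omega⟩, by simp only; omega⟩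
    rcases Nat.eq_zero_or_pos i with rfl | hi0
    · rcases Int.units_eq_one_or s with rfl | rfl
      · refine ⟨Sum.inr 0, trivial, Sum.inl j, trivial, ((hlr _ _).2 ?_).symm, by simp [hcr],
          hcl j, ?_⟩
        · simp only [Fin.val_zero]
          omega
        · rw [Sym2.eq_swap, mul_right_comm, hsign, if_pos (by simp only [Fin.val_zero]; omega)]
      · refine ⟨Sum.inr (Fin.last (2 * p)), trivial, Sum.inl j, trivial, ((hlr _ _).2 ?_).symm, ?_,
          hcl j, ?_⟩
        · simp only [Fin.val_last]
          omega
        · rw [hcr]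
          simp only [Fin.val_last]
          split_ifs <;> omega
        · rw [Sym2.eq_swap, mul_right_comm, hsign, if_neg (by simp only [Fin.val_last]; omega)]
    · obtain ⟨i, rfl⟩ : ∃ i' : Fin p, i = i'.val + 1 := ⟨⟨i - 1, by omega⟩, by simp only; omega⟩
      rcases Int.units_eq_one_or s with rfl | rfl
      · by_cases hjr : j.val < r
        · refine ⟨Sum.inl i, trivial, Sum.inr ⟨j.val, by omega⟩, trivial, (hlr _ _).2 ?_, hcl i, ?_,
            ?_⟩
          · simp only
            omega
          · rw [hcr, if_neg (by simp only; omega), if_pos j.isLt]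
          · rw [hsign, if_pos hjr]
        -- Here `j = p - 1 = r`, so `v_j` is not switched. The positive edge comes from `v_i u_j` if
        -- `i ≥ 1`, and for `i = 0` from the additional edge `u_0 u_{p-1}`.
        · by_cases hi0 : i.val = 0
          · obtain ⟨h1, h2⟩ := hpos i j hi0 (by rw [Fin.lt_def]; omega) (by omega)
            exact ⟨Sum.inl i, trivial, Sum.inl j, trivial, h1, hcl i, hcl j, by
              rw [h2, htl, htl]; rfl⟩
          · refine ⟨Sum.inr ⟨i.val, by omega⟩, trivial, Sum.inl j, trivial, ((hlr _ _).2 ?_).symm, ?_,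
              hcl j, ?_⟩
            · simp only
              omega
            · rw [hcr, if_neg (by simp only; omega), if_pos i.isLt]
            · rw [Sym2.eq_swap, mul_right_comm, hsign, if_pos (by simp only; omega)]
      · obtain ⟨x, hx, hpx⟩ := hloop j
        refine ⟨Sum.inl i, trivial, Sum.inr x, trivial, (hlr _ _).2 ?_, hcl i, hx, ?_⟩
        · omega
        · rw [hsign, if_neg (by omega)]

/-- The side of the `u_i` is a cover of size `p`, and `u_1`, `u_p` are not met by the removed
matching, so they are the twins for `PartialColouring.lt_of_cover`. -/
theorem achromaticNumber_bipartiteMinusMatching_le {p : ℕ} (hp : 2 ≤ p)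
    {σ : Sym2 (Fin p ⊕ Fin (2 * p + 1)) → ℤˣ}
    (hσ : ∀ u v, (bipartiteMinusMatching p).Adj u v → σ s(u, v) = -1) :
    achromaticNumber (bipartiteMinusMatching p) σ ≤ 2 * p - 1 := by
  refine achromaticNumber_le fun k c t h => ?_
  have hmem : ∀ i, Sum.inl i ∈ (Finset.univ.map Function.Embedding.inl :
      Finset (Fin p ⊕ Fin (2 * p + 1))) := fun i => Finset.mem_map_of_mem _ (Finset.mem_univ i)
  have := h.lt_of_cover hσ (C := Finset.univ.map Function.Embedding.inl)
    (a := Sum.inl ⟨0, by omega⟩) (b := Sum.inl ⟨p - 1, by omega⟩) ?_ (hmem _) (hmem _) ?_ ?_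
  · rw [Finset.card_map, Finset.card_univ, Fintype.card_fin] at this
    omega
  · rintro (i | i) (j | j) hij
    · exact Or.inl (hmem i)
    · exact Or.inl (hmem i)
    · exact Or.inr (hmem j)
    · exact absurd hij (bipartiteMinusMatching_inr_inr i j)
  · rw [ne_eq, Sum.inl.injEq, Fin.mk.injEq]
    omega
  · rintro (i | j) hx
    · exact absurd (hmem i) hx
    · rw [bipartiteMinusMatching_inl_inr, bipartiteMinusMatching_inl_inr]
      constructor <;> rintro ⟨-, h1, h2⟩ <;> simp only at h1 h2 <;> omega

theorem bipartiteEdge_mem {p : ℕ} (hp : 1 ≤ p) :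
    bipartiteEdge p hp ∈ (bipartiteMinusMatching p).edgeSet := by
  refine (bipartiteMinusMatching_inl_inr _ _).2 ?_
  rintro ⟨-, -, h⟩
  simp only at h
  omega

/-- Deleting `u_p v_p` extends the removed matching to the last index, which is the case `r = p` of
the explicit colouring. -/
theorem le_achromaticNumber_deleteEdges_bipartiteEdge {p : ℕ} (hp : 2 ≤ p) (hp' : 1 ≤ p) : 2 * p + 1 ≤
    achromaticNumber ((bipartiteMinusMatching p).deleteEdges {bipartiteEdge p hp'})
      (allNegative _) := by
  refine le_achromaticNumber_bipartite le_rfl hp' (Nat.le_succ p) (fun i j => ?_) (fun i j h => ?_)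
    (fun _ _ => rfl) fun i j _ _ hj => absurd hj (by omega)
  · rw [SimpleGraph.deleteEdges_adj, bipartiteMinusMatching_inl_inr, Set.mem_singleton_iff,
      bipartiteEdge, Sym2.eq_iff]
    simp only [Sum.inl.injEq, Sum.inr.injEq, Fin.ext_iff, reduceCtorEq, and_false, or_false]
    omega
  · exact bipartiteMinusMatching_inr_inr i j (SimpleGraph.deleteEdges_adj.1 h).1

/-- The achromatic numbers of `(B_p, -)` and `(B_p - u_p v_p, -)`. -/
theorem achromaticNumber_bipartiteMinusMatching {p : ℕ} (hp : 2 ≤ p) (hp' : 1 ≤ p) :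
    achromaticNumber (bipartiteMinusMatching p) (allNegative _) = 2 * p - 1 ∧
      achromaticNumber ((bipartiteMinusMatching p).deleteEdges {bipartiteEdge p hp'})
        (allNegative _) = 2 * p + 1 := by
  have h1 := achromaticNumber_bipartiteMinusMatching_le hp (σ := allNegative _) fun _ _ _ => rfl
  have h2 := le_achromaticNumber_deleteEdges_bipartiteEdge hp hp'
  have h3 := achromaticNumber_deleteEdges_le (bipartiteMinusMatching p) (allNegative _)
    (bipartiteEdge p hp')
  omega

/-- Deleting the positive edge `u_1 u_p` from the graph `B_p + u_1 u_p`, in which all other edges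
are negative, lowers the achromatic number by two. -/
theorem exists_achromaticNumber_odd {p : ℕ} (hp : 2 ≤ p) :
    ∃ (G : SimpleGraph (Fin p ⊕ Fin (2 * p + 1))) (σ : Sym2 (Fin p ⊕ Fin (2 * p + 1)) → ℤˣ),
      ∃ e ∈ G.edgeSet, achromaticNumber G σ = 2 * p + 1 ∧
        achromaticNumber (G.deleteEdges {e}) σ = 2 * p - 1 := by
  let a : Fin p ⊕ Fin (2 * p + 1) := Sum.inl ⟨0, by omega⟩
  let b : Fin p ⊕ Fin (2 * p + 1) := Sum.inl ⟨p - 1, by omega⟩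
  have hab : a ≠ b := by
    simp only [a, b, ne_eq, Sum.inl.injEq, Fin.mk.injEq]
    omega
  let G := bipartiteMinusMatching p ⊔ SimpleGraph.edge a b
  have hadj : ∀ u v, G.Adj u v ↔ (bipartiteMinusMatching p).Adj u v ∨ s(u, v) = s(a, b) := by
    intro u v
    simp only [G, SimpleGraph.sup_adj, SimpleGraph.edge_adj, Sym2.eq_iff]
    refine or_congr_right (and_iff_left_of_imp ?_)
    rintro (⟨rfl, rfl⟩ | ⟨rfl, rfl⟩)
    · exact hab
    · exact hab.symm
  have hdel : G.deleteEdges {s(a, b)} = bipartiteMinusMatching p := by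
    ext u v
    rw [SimpleGraph.deleteEdges_adj, hadj, Set.mem_singleton_iff, or_and_right, and_not_self_iff,
      or_false]
    refine and_iff_left_of_imp fun h he => ?_
    rcases Sym2.eq_iff.1 he with ⟨rfl, rfl⟩ | ⟨rfl, rfl⟩ <;>
      exact bipartiteMinusMatching_inl_inl _ _ h
  have hedge : s(a, b) ∈ G.edgeSet := (hadj a b).2 (Or.inr rfl)
  refine ⟨G, positiveAt s(a, b), s(a, b), hedge, ?_⟩
  have hne : ∀ x j, (s(x, Sum.inr j) : Sym2 (Fin p ⊕ Fin (2 * p + 1))) ≠ s(a, b) := by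
    intro x j he
    rcases Sym2.eq_iff.1 he with ⟨-, h⟩ | ⟨-, h⟩ <;> exact absurd h Sum.inr_ne_inl
  have h1 : 2 * p + 1 ≤ achromaticNumber G (positiveAt s(a, b)) := by
    refine le_achromaticNumber_bipartite (r := p - 1) (Nat.sub_le _ _) (by omega) (by omega)
      (fun i j => ?_) (fun i j h => ?_) (fun i j => if_neg (hne _ j)) fun i j hi _ hj => ?_
    · rw [hadj, or_iff_left (hne _ j), bipartiteMinusMatching_inl_inr]
      omega
    · rcases (hadj _ _).1 h with h | h
      · exact bipartiteMinusMatching_inr_inr i j h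
      · exact hne _ j h
    · have hia : Sum.inl i = a := congrArg Sum.inl (Fin.ext hi)
      have hjb : Sum.inl j = b := congrArg Sum.inl (Fin.ext (by simp only; omega))
      rw [hia, hjb]
      exact ⟨hedge, if_pos rfl⟩
  have h2 := achromaticNumber_le_deleteEdges G (positiveAt s(a, b)) s(a, b)
  have h3 := achromaticNumber_bipartiteMinusMatching_le hp (σ := positiveAt s(a, b))
    fun u v huv => if_neg fun he => by
      rw [← hdel, SimpleGraph.deleteEdges_adj] at huv
      exact huv.2 he
  rw [hdel] at h2 ⊢
  omega

end SignedGraph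

/-! ### The main theorem -/

theorem theorem3p6 :
    -- the two bounds
    (∀ (V : Type*) [Finite V] (G : SimpleGraph V) (σ : Sym2 V → ℤˣ), ∀ e ∈ G.edgeSet,
      (SignedGraph.achromaticNumber G σ : ℤ) - 2
          ≤ SignedGraph.achromaticNumber (G.deleteEdges {e}) σ ∧
        (SignedGraph.achromaticNumber (G.deleteEdges {e}) σ : ℤ)
          ≤ SignedGraph.achromaticNumber G σ + 2) ∧
    -- the lower bound is attained for every value at least 5
    (∀ k : ℕ, 5 ≤ k → ∃ (n : ℕ) (G : SimpleGraph (Fin n)) (σ : Sym2 (Fin n) → ℤˣ),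
      ∃ e ∈ G.edgeSet, SignedGraph.achromaticNumber G σ = k ∧
        (SignedGraph.achromaticNumber (G.deleteEdges {e}) σ : ℤ) = (k : ℤ) - 2) ∧
    -- the upper bound is attained for every value at least 6
    (∀ k : ℕ, 6 ≤ k → ∃ (n : ℕ) (G : SimpleGraph (Fin n)) (σ : Sym2 (Fin n) → ℤˣ),
      ∃ e ∈ G.edgeSet, SignedGraph.achromaticNumber G σ = k ∧
        SignedGraph.achromaticNumber (G.deleteEdges {e}) σ = k + 2) ∧
    -- the recursive family `H_p`, with `p = q + 3`: the values are `2p - 2` and `2p`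
    (∀ q : ℕ, SignedGraph.familyEdge q ∈ (SignedGraph.cliqueFamily q).edgeSet ∧
      SignedGraph.achromaticNumber (SignedGraph.cliqueFamily q)
        (SignedGraph.allNegative _) = 2 * (q + 3) - 2 ∧
      SignedGraph.achromaticNumber
        ((SignedGraph.cliqueFamily q).deleteEdges {SignedGraph.familyEdge q})
        (SignedGraph.allNegative _) = 2 * (q + 3)) ∧
    -- complete bipartite graphs minus a matching: the values are `2p - 1` and `2p + 1`
    (∀ (p : ℕ) (hp : 3 ≤ p),
      SignedGraph.bipartiteEdge p (by omega) ∈ (SignedGraph.bipartiteMinusMatching p).edgeSet ∧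
      SignedGraph.achromaticNumber (SignedGraph.bipartiteMinusMatching p)
        (SignedGraph.allNegative _) = 2 * p - 1 ∧
      SignedGraph.achromaticNumber
        ((SignedGraph.bipartiteMinusMatching p).deleteEdges
          {SignedGraph.bipartiteEdge p (by omega)})
        (SignedGraph.allNegative _) = 2 * p + 1) := by
  refine ⟨fun V _ G σ e _ => ?_, fun k hk => ?_, fun k hk => ?_, fun q =>
    ⟨SignedGraph.familyEdge_mem q, SignedGraph.achromaticNumber_cliqueFamily q⟩, fun p hp =>
    ⟨SignedGraph.bipartiteEdge_mem (by omega),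
      SignedGraph.achromaticNumber_bipartiteMinusMatching (by omega) (by omega)⟩⟩
  · have h1 := SignedGraph.achromaticNumber_le_deleteEdges G σ e
    have h2 := SignedGraph.achromaticNumber_deleteEdges_le G σ e
    omega
  · rcases Nat.even_or_odd' k with ⟨p, rfl | rfl⟩
    · obtain ⟨q, rfl⟩ : ∃ q, p = q + 3 := ⟨p - 3, by omega⟩
      obtain ⟨h1, h2⟩ := SignedGraph.achromaticNumber_positiveAt q
      obtain ⟨n, G, σ, e, he, h3, h4⟩ := SignedGraph.exists_fin_of_exists
        (σ := SignedGraph.positiveAt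
          s(SignedGraph.baseVertex q 0, SignedGraph.baseVertex q 1))
        ((SignedGraph.cliqueFamily q).mem_edgeSet.2 (SignedGraph.baseVertex_adj q (by decide)
          ((SignedGraph.baseVertex_injective q).ne (by decide : (1 : Fin 8) ≠ 0))))
      exact ⟨n, G, σ, e, he, by omega, by omega⟩
    · obtain ⟨G, σ, e, he, h1, h2⟩ := SignedGraph.exists_achromaticNumber_odd (p := p) (by omega)
      obtain ⟨n, G, σ, e, he, h3, h4⟩ := SignedGraph.exists_fin_of_exists (σ := σ) he
      exact ⟨n, G, σ, e, he, by omega, by omega⟩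
  · rcases Nat.even_or_odd' k with ⟨p, rfl | rfl⟩
    -- The value for `H_{q+3}` is `2(q + 3) - 2`, hence the shift by two.
    · obtain ⟨q, rfl⟩ : ∃ q, p = q + 2 := ⟨p - 2, by omega⟩
      obtain ⟨h1, h2⟩ := SignedGraph.achromaticNumber_cliqueFamily q
      obtain ⟨n, G, σ, e, he, h3, h4⟩ := SignedGraph.exists_fin_of_exists
        (σ := SignedGraph.allNegative _) (SignedGraph.familyEdge_mem q)
      exact ⟨n, G, σ, e, he, by omega, by omega⟩
    -- The graph `B_{p+1}` is the one with value `2(p + 1) - 1 = 2p + 1`.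
    · obtain ⟨h1, h2⟩ := SignedGraph.achromaticNumber_bipartiteMinusMatching (p := p + 1)
        (by omega) (by omega)
      obtain ⟨n, G, σ, e, he, h3, h4⟩ := SignedGraph.exists_fin_of_exists
        (σ := SignedGraph.allNegative _)
        (SignedGraph.bipartiteEdge_mem (p := p + 1) (by omega))
      exact ⟨n, G, σ, e, he, by omega, by omega⟩
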